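/- $\mathsf{WKL}_0$ proves the following statement: every partial order with an infinite antichain has an initial interval that is not a finite union of ideals. Here everything is understood in the language of second order arithmetic, with number variables, set variables, and $0,1,+,\cdot,<,\in$. $\mathsf{WKL}_0$ is the theory consisting of the basic axioms for $0,1,+,\cdot,<$, the induction scheme for $\Sigma^0_1$ formulas, the comprehension scheme for $\Delta^0_1$ properties (number and set parameters being allowed in both schemes), and weak König's lemma: every infinite tree $T\subseteq 2^{<\mathbb{N}}$ has a path. A theory proves a sentence if the sentence is derivable from it in two-sorted first order logic or, equivalently, if it holds in all structures $(M,\mathcal{S},0,1,+,\cdot,<)$ with $\emptyset\ne\mathcal{S}\subseteq\mathcal{P}(M)$ which satisfy the theory, where number variables range over $M$ and set variables over $\mathcal{S}$. The notions in the statement are formalized as follows. A pair $(x,y)$ is coded by the number $(x+y)^2+x$. A partial order is a set $P\subseteq\mathbb{N}$ with a set ${\preceq}\subseteq P\times P$ that is reflexive, antisymmetric and transitive. A set $X$ is infinite if for every $b$ there is $a\in X$ with $a\not<b$. An antichain is a set $D\subseteq P$ such that no two distinct $x,y\in D$ satisfy $x\preceq y$ or $y\preceq x$. An initial interval of $P$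 is a set $I\subseteq P$ such that for all $x,y\in P$, if $x\preceq y$ and $y\in I$ then $x\in I$. An ideal of $P$ is an initial interval $A$ of $P$ such that for all $x,y\in A$ there is $z\in A$ with $x\preceq z$ and $y\preceq z$. A set $I$ is a finite union of ideals if there are a number $k$ and a sequence of sets $(A_i)_{i}$, coded by the single set $\{(x,i) : x\in A_i\}$, such that $A_i$ is an ideal of $P$ for every $i<k$ and $I=\bigcup_{i<k}A_i$. -/

import Mathlib

universe u

namespace SOA

/-! ## The language of second order arithmetic

Two sorts of variables (numbers and sets), each named by natural numbers. -/

/-- Numerical terms. -/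
inductive Term : Type
  | var (x : ℕ)
  | zero
  | one
  | add (s t : Term)
  | mul (s t : Term)

instance : Zero Term := ⟨Term.zero⟩
instance : One Term := ⟨Term.one⟩
instance : Add Term := ⟨Term.add⟩
instance : Mul Term := ⟨Term.mul⟩

/-- Formulas. In `allN x φ`, `exN x φ` the number variable `x` is bound, in `allS X φ`, `exS X φ`
the set variable `X` is bound. There is no primitive equality between sets. -/
inductive Formula : Type
  | eq (s t : Term)
  | lt (s t : Term)
  | mem (t : Term) (X : ℕ)
  | neg (φ : Formula)
  | and (φ ψ : Formula)
  | or (φ ψ : Formula)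
  | imp (φ ψ : Formula)
  | iff (φ ψ : Formula)
  | allN (x : ℕ) (φ : Formula)
  | exN (x : ℕ) (φ : Formula)
  | allS (X : ℕ) (φ : Formula)
  | exS (X : ℕ) (φ : Formula)

open Formula

prefix:max "#" => Term.var
infix:50 " =₂ " => Formula.eq
infix:50 " <₂ " => Formula.lt
infix:50 " ∈₂ " => Formula.mem
prefix:45 "¬₂ " => Formula.neg
infixr:40 " ∧₂ " => Formula.and
infixr:38 " ∨₂ " => Formula.or
infixr:35 " ⇒₂ " => Formula.imp
infix:33 " ⇔₂ " => Formula.iff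

/-- The (number) variables of a term. -/
def Term.vars : Term → Finset ℕ
  | .var x => {x}
  | .zero => ∅
  | .one => ∅
  | .add s t => s.vars ∪ t.vars
  | .mul s t => s.vars ∪ t.vars

/-- The free number variables of a formula. -/
def Formula.freeN : Formula → Finset ℕ
  | .eq s t => s.vars ∪ t.vars
  | .lt s t => s.vars ∪ t.vars
  | .mem t _ => t.vars
  | .neg φ => φ.freeN
  | .and φ ψ => φ.freeN ∪ ψ.freeN
  | .or φ ψ => φ.freeN ∪ ψ.freeN
  | .imp φ ψ => φ.freeN ∪ ψ.freeN
  | .iff φ ψ => φ.freeN ∪ ψ.freeN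
  | .allN x φ => φ.freeN.erase x
  | .exN x φ => φ.freeN.erase x
  | .allS _ φ => φ.freeN
  | .exS _ φ => φ.freeN

/-- The free set variables of a formula. -/
def Formula.freeS : Formula → Finset ℕ
  | .eq _ _ => ∅
  | .lt _ _ => ∅
  | .mem _ X => {X}
  | .neg φ => φ.freeS
  | .and φ ψ => φ.freeS ∪ ψ.freeS
  | .or φ ψ => φ.freeS ∪ ψ.freeS
  | .imp φ ψ => φ.freeS ∪ ψ.freeS
  | .iff φ ψ => φ.freeS ∪ ψ.freeS
  | .allN _ φ => φ.freeS
  | .exN _ φ => φ.freeS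
  | .allS X φ => φ.freeS.erase X
  | .exS X φ => φ.freeS.erase X

/-! ## Structures and satisfaction -/

/-- A structure for the language of second order arithmetic: the number variables range over
`carrier`, the set variables over a nonempty collection `sets` of subsets of `carrier`. -/
structure Structure where
  carrier : Type u
  zero : carrier
  one : carrier
  add : carrier → carrier → carrier
  mul : carrier → carrier → carrier
  lt : carrier → carrier → Prop
  sets : Set (Set carrier)
  sets_nonempty : sets.Nonempty

/-- The value of a term. -/
def Term.eval (M : Structure.{u}) (v : ℕ → M.carrier) : Term → M.carrier
  | .var x => v x
  | .zero => M.zero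
  | .one => M.one
  | .add s t => M.add (s.eval M v) (t.eval M v)
  | .mul s t => M.mul (s.eval M v) (t.eval M v)

/-- Truth of a formula in `M` under an assignment `v` of the number variables and an assignment
`V` of the set variables. -/
def Formula.Realize (M : Structure.{u}) :
    Formula → (ℕ → M.carrier) → (ℕ → Set M.carrier) → Prop
  | .eq s t, v, _ => s.eval M v = t.eval M v
  | .lt s t, v, _ => M.lt (s.eval M v) (t.eval M v)
  | .mem t X, v, V => t.eval M v ∈ V X
  | .neg φ, v, V => ¬ φ.Realize M v V
  | .and φ ψ, v, V => φ.Realize M v V ∧ ψ.Realize M v V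
  | .or φ ψ, v, V => φ.Realize M v V ∨ ψ.Realize M v V
  | .imp φ ψ, v, V => φ.Realize M v V → ψ.Realize M v V
  | .iff φ ψ, v, V => φ.Realize M v V ↔ ψ.Realize M v V
  | .allN x φ, v, V => ∀ a : M.carrier, φ.Realize M (Function.update v x a) V
  | .exN x φ, v, V => ∃ a : M.carrier, φ.Realize M (Function.update v x a) V
  | .allS X φ, v, V => ∀ A ∈ M.sets, φ.Realize M v (Function.update V X A)
  | .exS X φ, v, V => ∃ A ∈ M.sets, φ.Realize M v (Function.update V X A)

/-- `M` satisfies (the universal closure of) `φ`. -/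
def Structure.Satisfies (M : Structure.{u}) (φ : Formula) : Prop :=
  ∀ (v : ℕ → M.carrier) (V : ℕ → Set M.carrier), (∀ X, V X ∈ M.sets) → φ.Realize M v V

/-- The theory `T` proves `φ`: `φ` holds in every model of `T`. The set quantifiers range
over the sets of the model only, so this is consequence in two-sorted first order logic, which by
the soundness and completeness theorems is the same as derivability from `T`. -/
def Entails (T : Set Formula) (φ : Formula) : Prop :=
  ∀ M : Structure.{u}, (∀ ψ ∈ T, M.Satisfies ψ) → M.Satisfies φ

/-! ## The theory `RCA0` -/

/-- `Σ⁰₀` formulas: no set quantifiers, and all number quantifiers are bounded, that is, of the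
form `∀ x < t` or `∃ x < t` for a term `t` in which `x` does not occur. -/
inductive IsSigma00 : Formula → Prop
  | eq (s t : Term) : IsSigma00 (s =₂ t)
  | lt (s t : Term) : IsSigma00 (s <₂ t)
  | mem (t : Term) (X : ℕ) : IsSigma00 (t ∈₂ X)
  | neg {φ : Formula} : IsSigma00 φ → IsSigma00 (¬₂ φ)
  | and {φ ψ : Formula} : IsSigma00 φ → IsSigma00 ψ → IsSigma00 (φ ∧₂ ψ)
  | or {φ ψ : Formula} : IsSigma00 φ → IsSigma00 ψ → IsSigma00 (φ ∨₂ ψ)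
  | imp {φ ψ : Formula} : IsSigma00 φ → IsSigma00 ψ → IsSigma00 (φ ⇒₂ ψ)
  | iff {φ ψ : Formula} : IsSigma00 φ → IsSigma00 ψ → IsSigma00 (φ ⇔₂ ψ)
  | ball {φ : Formula} (x : ℕ) (t : Term) : x ∉ t.vars → IsSigma00 φ →
      IsSigma00 (allN x (#x <₂ t ⇒₂ φ))
  | bex {φ : Formula} (x : ℕ) (t : Term) : x ∉ t.vars → IsSigma00 φ →
      IsSigma00 (exN x (#x <₂ t ∧₂ φ))

/-- `Σ⁰₁` formulas. -/
def IsSigma01 (φ : Formula) : Prop := ∃ (x : ℕ) (θ : Formula), IsSigma00 θ ∧ φ = exN x θ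

/-- `Π⁰₁` formulas. -/
def IsPi01 (φ : Formula) : Prop := ∃ (x : ℕ) (θ : Formula), IsSigma00 θ ∧ φ = allN x θ

/-- The basic axioms for `0, 1, +, ·, <`. -/
def basicAxioms : Set Formula :=
  { ¬₂ (#0 + 1 =₂ 0),
    #0 + 1 =₂ #1 + 1 ⇒₂ #0 =₂ #1,
    #0 + 0 =₂ #0,
    #0 + (#1 + 1) =₂ (#0 + #1) + 1,
    #0 * 0 =₂ 0,
    #0 * (#1 + 1) =₂ #0 * #1 + #0,
    ¬₂ (#0 <₂ 0),
    #0 <₂ #1 + 1 ⇔₂ (#0 <₂ #1 ∨₂ #0 =₂ #1) }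

/-- Induction for `φ` in the variable `x`: if `φ(0)` and `∀ x (φ(x) → φ(x + 1))`, then `∀ x φ(x)`.
The auxiliary variable `y` (different from `x` and not free in `φ`) serves to write `φ(0)` and
`φ(x + 1)` without substitution: `φ(0)` is `∀ x (x = 0 → φ)`, and `φ(x + 1)` is
`∀ y (y = x + 1 → ∀ x (x = y → φ))`. -/
def inductionAxiom (φ : Formula) (x y : ℕ) : Formula :=
  (allN x (#x =₂ 0 ⇒₂ φ) ∧₂
    allN x (φ ⇒₂ allN y (#y =₂ #x + 1 ⇒₂ allN x (#x =₂ #y ⇒₂ φ)))) ⇒₂ allN x φ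

/-- Comprehension for a property of `x` expressed both by `φ` and by `ψ`:
`∀ x (φ ↔ ψ) → ∃ X ∀ x (x ∈ X ↔ φ)`. -/
def comprehensionAxiom (φ ψ : Formula) (x X : ℕ) : Formula :=
  allN x (φ ⇔₂ ψ) ⇒₂ exS X (allN x (#x ∈₂ X ⇔₂ φ))

/-- The theory `RCA0`: basic axioms, `Σ⁰₁` induction, `Δ⁰₁` comprehension. -/
def RCA0 : Set Formula :=
  basicAxioms
  ∪ {χ | ∃ (φ : Formula) (x y : ℕ), IsSigma01 φ ∧ y ≠ x ∧ y ∉ φ.freeN ∧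
      χ = inductionAxiom φ x y}
  ∪ {χ | ∃ (φ ψ : Formula) (x X : ℕ), IsSigma01 φ ∧ IsPi01 ψ ∧ X ∉ φ.freeS ∧
      χ = comprehensionAxiom φ ψ x X}

/-! ## Coding of finite sets and binary strings, weak König's lemma

The auxiliary formulas below bind the number variables named in their descriptions; the terms
plugged into them use only variables with smaller names. -/

/-- The code `(s + t)² + s` of the pair `(s, t)`. -/
def pair (s t : Term) : Term := (s + t) * (s + t) + s

/-- `X` is infinite: `∀ b ∃ a (a ∈ X ∧ ¬ a < b)`. Binds 30, 31. -/
def infinite (X : ℕ) : Formula :=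
  allN 30 (exN 31 (#31 ∈₂ X ∧₂ ¬₂ (#31 <₂ #30)))

/-- `c` is a triple `(k, (m, n))`; the finite set described by such a triple is
`{i | i < k and m (i + 1) + 1 divides n}`. Binds 20, 21, 22. -/
def isTriple (c : Term) : Formula :=
  exN 20 (exN 21 (exN 22 (c =₂ pair #20 (pair #21 #22))))

/-- `i` is in the finite set described by the triple `c`. Binds 20, 21, 22, 23. -/
def inFin (i c : Term) : Formula :=
  exN 20 (exN 21 (exN 22 (c =₂ pair #20 (pair #21 #22) ∧₂ i <₂ #20 ∧₂
    exN 23 (#22 =₂ #23 * (#21 * (i + 1) + 1)))))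

/-- `c` is the code of a finite set: the least triple that describes this set.
Binds 18, 19 and 20, 21, 22, 23. -/
def isFinCode (c : Term) : Formula :=
  isTriple c ∧₂
  ¬₂ exN 18 (#18 <₂ c ∧₂ isTriple #18 ∧₂ allN 19 (inFin #19 #18 ⇔₂ inFin #19 c))

/-- `s` is the code of a binary string of length `l`, that is, of the finite set of pairs
`{(i, σ(i)) | i < l}` for a function `σ` from `{i | i < l}` to `{0, 1}`.
Binds 15, 16, 17 and 18 to 23. -/
def isBinString (s l : Term) : Formula :=
  isFinCode s ∧₂
  allN 15 (inFin #15 s ⇒₂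
    exN 16 (exN 17 (#15 =₂ pair #16 #17 ∧₂ #16 <₂ l ∧₂ (#17 =₂ 0 ∨₂ #17 =₂ 1)))) ∧₂
  allN 16 (#16 <₂ l ⇒₂ (inFin (pair #16 0) s ⇔₂ ¬₂ inFin (pair #16 1) s))

/-- The set `T` is a tree of binary strings: it contains only codes of binary strings and is closed
under initial segments (`t` is an initial segment of `s` iff it is included in `s` as a set of
pairs). Binds 10, 11, 12, 13 and 15 to 23. -/
def isBinTree (T : ℕ) : Formula :=
  allN 10 (#10 ∈₂ T ⇒₂ exN 12 (isBinString #10 #12)) ∧₂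
  allN 10 (allN 11 ((#10 ∈₂ T ∧₂ exN 12 (isBinString #11 #12) ∧₂
    allN 13 (inFin #13 #11 ⇒₂ inFin #13 #10)) ⇒₂ #11 ∈₂ T))

/-- The set `F` of pairs is (the graph of) a function from the numbers to `{0, 1}`.
Binds 10, 11, 12. -/
def isBinFunction (F : ℕ) : Formula :=
  allN 10 (#10 ∈₂ F ⇒₂
    exN 11 (exN 12 (#10 =₂ pair #11 #12 ∧₂ (#12 =₂ 0 ∨₂ #12 =₂ 1)))) ∧₂
  allN 11 (pair #11 0 ∈₂ F ⇔₂ ¬₂ (pair #11 1 ∈₂ F))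

/-- `F` is a path in `T`: a function to `{0, 1}` all of whose finite initial segments are in `T`. -/
def isPath (F T : ℕ) : Formula :=
  isBinFunction F ∧₂
  allN 10 (exN 11 (#11 ∈₂ T ∧₂ isBinString #11 #10 ∧₂ allN 13 (inFin #13 #11 ⇒₂ #13 ∈₂ F)))

/-- Weak König's lemma: every infinite tree of binary strings has a path. -/
def weakKonig : Formula :=
  allS 0 ((isBinTree 0 ∧₂ infinite 0) ⇒₂ exS 1 (isPath 1 0))

/-- The theory `WKL0`. -/
def WKL0 : Set Formula := RCA0 ∪ {weakKonig}

/-! ## Partial orders -/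

/-- `(P, R)` is a partial order: `R` is a set of (codes of) pairs of elements of `P` which is
reflexive on `P`, antisymmetric and transitive. -/
def isPartialOrder (P R : ℕ) : Formula :=
  allN 0 (#0 ∈₂ R ⇒₂ exN 1 (exN 2 (#0 =₂ pair #1 #2 ∧₂ #1 ∈₂ P ∧₂ #2 ∈₂ P))) ∧₂
  allN 0 (#0 ∈₂ P ⇒₂ pair #0 #0 ∈₂ R) ∧₂
  allN 0 (allN 1 ((pair #0 #1 ∈₂ R ∧₂ pair #1 #0 ∈₂ R) ⇒₂ #0 =₂ #1)) ∧₂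
  allN 0 (allN 1 (allN 2 ((pair #0 #1 ∈₂ R ∧₂ pair #1 #2 ∈₂ R) ⇒₂ pair #0 #2 ∈₂ R)))

/-- `D` is an antichain of `(P, R)`. -/
def isAntichain (P R D : ℕ) : Formula :=
  allN 0 (#0 ∈₂ D ⇒₂ #0 ∈₂ P) ∧₂
  allN 0 (allN 1 ((#0 ∈₂ D ∧₂ #1 ∈₂ D ∧₂ ¬₂ (#0 =₂ #1)) ⇒₂
    (¬₂ (pair #0 #1 ∈₂ R) ∧₂ ¬₂ (pair #1 #0 ∈₂ R))))

/-- The class `A` (given by the formula expressing membership in it) is an initial interval of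
`(P, R)`. Binds 0, 1. -/
def isInitialInterval (P R : ℕ) (A : Term → Formula) : Formula :=
  allN 0 (A #0 ⇒₂ #0 ∈₂ P) ∧₂
  allN 0 (allN 1 ((#0 ∈₂ P ∧₂ #1 ∈₂ P ∧₂ pair #0 #1 ∈₂ R ∧₂ A #1) ⇒₂ A #0))

/-- `A` is an ideal of `(P, R)`: an initial interval in which any two elements are compatible.
Binds 0, 1, 2. -/
def isIdeal (P R : ℕ) (A : Term → Formula) : Formula :=
  isInitialInterval P R A ∧₂
  allN 0 (allN 1 ((A #0 ∧₂ A #1) ⇒₂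
    exN 2 (A #2 ∧₂ pair #0 #2 ∈₂ R ∧₂ pair #1 #2 ∈₂ R)))

/-- `I` is a finite union of ideals of `(P, R)`: there are a number `k` (variable 5) and a set `S`
(set variable 10) coding a sequence of sets `S_i = {x | (x, i) ∈ S}`, such that each `S_i` with
`i < k` is an ideal and `I` is the union of these. -/
def isFiniteUnionOfIdeals (P R I : ℕ) : Formula :=
  exN 5 (exS 10 (
    allN 6 (#6 <₂ #5 ⇒₂ isIdeal P R (fun t => pair t #6 ∈₂ 10)) ∧₂
    allN 0 (#0 ∈₂ I ⇔₂ exN 6 (#6 <₂ #5 ∧₂ pair #0 #6 ∈₂ 10))))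

/-- Every partial order with an infinite antichain has an initial interval which is not a finite
union of ideals. -/
def antichainStatement : Formula :=
  allS 0 (allS 1 ((isPartialOrder 0 1 ∧₂ exS 2 (isAntichain 0 1 2 ∧₂ infinite 2)) ⇒₂
    exS 3 (isInitialInterval 0 1 (fun t => t ∈₂ 3) ∧₂ ¬₂ isFiniteUnionOfIdeals 0 1 3)))

end SOA

/-!
Let `D` be an infinite antichain of the partial order `P`. The downward closure of `D` would be an
initial interval that is not a finite union of ideals, but it is only `Σ⁰₁` and need not be a set of
the model. All that is needed of it, however, is that it is an initial interval `I` which contains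
`D` and has no element above two distinct elements of `D`. If an ideal contained in such an `I` had
two distinct elements of `D`, an upper bound of them in the ideal would be an element of `I` above
both. So each ideal contains at most one element of `D`, and finitely many ideals do not cover `D`.

Such an `I` is obtained from weak König's lemma (`exists_separating_set`). The strings that look,
below their length `l`, like the characteristic function of such an `I` form a `Σ⁰₀` tree, and the
tree is infinite because the downward closure of the finite set `{d ∈ D | d < l}` provides a string
of length `l` (`exists_separatesBelow`).

In the last step the pigeonhole principle (`not_covered`) has to be proved from `Σ⁰₁` induction
alone. It follows from strong collection (`strong_collection`): one bound `w` works for all those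
`i < k` for which the `i`-th ideal meets `D`. The usual proof counts the `i` that meet `D` below
`w`. Here this count is replaced by a divisor of a fixed number `N ≠ 0` that increases whenever
another `i` is found: such a divisor cannot increase beyond `N`.

The argument is carried out in an arbitrary model `M`. Definability is handled by the type classes
`IsTerm`, `IsSig0` and `IsSig1` for functions and relations on tuples of elements of `M`, with
parameters, so that the formulas required by `sigma1_induction` and `sigma0_comprehension` are found
by instance search. Induction makes `M` an ordered commutative semiring; finite sets are coded by
the divisors of a number among the pairwise coprime moduli `m (i + 1) + 1`
(`dvd_of_dvd_modulus_mul`, `exists_finCode`).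
-/

namespace SOA

variable {M : Structure.{u}} {E : Type*}

/-! ### Definability with parameters -/

instance : Zero M.carrier := ⟨M.zero⟩
instance : One M.carrier := ⟨M.one⟩
instance : Add M.carrier := ⟨M.add⟩
instance : Mul M.carrier := ⟨M.mul⟩
instance : LT M.carrier := ⟨M.lt⟩

@[simp] theorem eval_zero (v : ℕ → M.carrier) : (0 : Term).eval M v = 0 := rfl
@[simp] theorem eval_one (v : ℕ → M.carrier) : (1 : Term).eval M v = 1 := rfl
@[simp] theorem eval_add (s t : Term) (v : ℕ → M.carrier) :
    (s + t).eval M v = s.eval M v + t.eval M v := rfl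
@[simp] theorem eval_mul (s t : Term) (v : ℕ → M.carrier) :
    (s * t).eval M v = s.eval M v * t.eval M v := rfl
@[simp] theorem lt_iff (a b : M.carrier) : M.lt a b ↔ a < b := Iff.rfl
@[simp] theorem eval_var (x : ℕ) (v : ℕ → M.carrier) : (Term.var x).eval M v = v x := rfl

/-- `E` is a type of finite tuples of elements of `M`. Only the types built from `Unit` by
`E ↦ E × M.carrier` matter: they are the contexts in which nested quantifiers are read, and the
component added by the `n`-th quantifier is `get e n`. -/
class Env (M : Structure.{u}) (E : Type*) where
  len : ℕ
  get : E → ℕ → M.carrier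

instance : Env M Unit := ⟨0, fun _ _ => M.zero⟩

instance [Env M E] : Env M (E × M.carrier) :=
  ⟨Env.len M E + 1, fun e i => if i = Env.len M E then e.2 else Env.get e.1 i⟩

/-- The assignments `v`, `V` list the number parameters `L`, then the components of `e`, and the
set parameters `S`. Variables further on are unconstrained, hence free for use as bound ones. -/
structure Fits [Env M E] (L : List M.carrier) (S : List (Set M.carrier)) (e : E)
    (v : ℕ → M.carrier) (V : ℕ → Set M.carrier) : Prop where
  num : ∀ i a, L[i]? = some a → v i = a
  set : ∀ i A, S[i]? = some A → V i = A
  env : ∀ i < Env.len M E, v (L.length + i) = Env.get e i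

/-- The function `f` is given by a term with parameters from `M`. The term is
demanded for every list of parameters that includes a suitable `L`, so that two such functions can
be combined over a common list without renaming variables. -/
class IsTerm (M : Structure.{u}) [Env M E] (f : E → M.carrier) : Prop where
  out : ∃ L : List M.carrier, ∀ L', L ⊆ L' → ∃ t : Term,
    (∀ x ∈ t.vars, x < L'.length + Env.len M E) ∧
    ∀ S e v V, Fits L' S e v V → t.eval M v = f e

/-- The relation `p` is defined by a `Σ⁰₀` formula with number and set parameters from `M`. -/
class IsSig0 (M : Structure.{u}) [Env M E] (p : E → Prop) : Prop where
  out : ∃ (L : List M.carrier) (S : List (Set M.carrier)), (∀ A ∈ S, A ∈ M.sets) ∧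
    ∀ L' S', L ⊆ L' → S ⊆ S' → ∃ φ : Formula, IsSigma00 φ ∧
      ∀ e v V, Fits L' S' e v V → (φ.Realize M v V ↔ p e)

/-- The relation `p` is defined by a `Σ⁰₁` formula with number and set parameters from `M`. -/
class IsSig1 (M : Structure.{u}) [Env M E] (p : E → Prop) : Prop where
  out : ∃ q : E × M.carrier → Prop, IsSig0 M q ∧ ∀ e, p e ↔ ∃ a, q (e, a)

namespace Fits

variable [Env M E] {L : List M.carrier} {S : List (Set M.carrier)} {e : E} {a : M.carrier}
  {v : ℕ → M.carrier} {V : ℕ → Set M.carrier}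

theorem fst {e : E × M.carrier} (h : Fits L S e v V) : Fits L S e.1 v V where
  num := h.num
  set := h.set
  env i hi := by
    rw [h.env i (Nat.lt_succ_of_lt hi)]
    simp [Env.get, hi.ne]

theorem snd {e : E × M.carrier} (h : Fits L S e v V) : v (L.length + Env.len M E) = e.2 := by
  rw [h.env _ (Nat.lt_succ_self _)]
  simp [Env.get]

theorem congr_num {w : ℕ → M.carrier} (h : Fits L S e v V)
    (hw : ∀ i < L.length + Env.len M E, w i = v i) : Fits L S e w V where
  num i b hb := by
    rw [hw i (by have := (List.getElem?_eq_some_iff.1 hb).1; omega), h.num i b hb]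
  set := h.set
  env i hi := by rw [hw _ (by omega), h.env i hi]

theorem extend {w : ℕ → M.carrier} (h : Fits L S e v V)
    (hw : ∀ i < L.length + Env.len M E, w i = v i) :
    Fits L S (e, w (L.length + Env.len M E)) w V where
  num := (h.congr_num hw).num
  set := h.set
  env i hi := by
    by_cases hi' : i = Env.len M E
    · simp [Env.get, hi']
    · have hi'' : i < Env.len M E := by
        have : i < Env.len M E + 1 := hi
        omega
      simpa [Env.get, hi'] using (h.congr_num hw).env i hi''

theorem update (h : Fits L S e v V) (a : M.carrier) :
    Fits L S (e, a) (Function.update v (L.length + Env.len M E) a) V := by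
  simpa using h.extend (w := Function.update v (L.length + Env.len M E) a)
    fun i hi => Function.update_of_ne hi.ne _ _

theorem congr_set {W : ℕ → Set M.carrier} (h : Fits L S e v V)
    (hW : ∀ i < S.length, W i = V i) : Fits L S e v W where
  num := h.num
  set i A hA := by rw [hW i (List.getElem?_eq_some_iff.1 hA).1, h.set i A hA]
  env := h.env

end Fits

theorem eval_congr {v w : ℕ → M.carrier} :
    ∀ t : Term, (∀ x ∈ t.vars, v x = w x) → t.eval M v = t.eval M w
  | .var x, h => h x (by simp [Term.vars])
  | .zero, _ => rfl
  | .one, _ => rfl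
  | .add s t, h => by
    simp only [Term.vars, Finset.mem_union] at h
    simp only [Term.eval, eval_congr s fun x hx => h x (.inl hx),
      eval_congr t fun x hx => h x (.inr hx)]
  | .mul s t, h => by
    simp only [Term.vars, Finset.mem_union] at h
    simp only [Term.eval, eval_congr s fun x hx => h x (.inl hx),
      eval_congr t fun x hx => h x (.inr hx)]

section Closure

variable [Env M E] {f g : E → M.carrier} {p q : E → Prop}

instance IsTerm.const (c : M.carrier) : IsTerm M fun _ : E => c where
  out := ⟨[c], fun L' h => by
    obtain ⟨i, hi, hc⟩ := List.mem_iff_getElem.1 (h (List.mem_singleton_self c))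
    refine ⟨.var i, fun x hx => ?_, fun S e v V hv => ?_⟩
    · simp only [Term.vars, Finset.mem_singleton] at hx; omega
    · exact hv.num i c (List.getElem?_eq_some_iff.2 ⟨hi, hc⟩)⟩

theorem IsTerm.fst (hf : IsTerm M f) : IsTerm M fun e : E × M.carrier => f e.1 where
  out := by
    obtain ⟨L, hL⟩ := hf.out
    refine ⟨L, fun L' h => ?_⟩
    obtain ⟨t, ht, ht'⟩ := hL L' h
    exact ⟨t, fun x hx => Nat.lt_succ_of_lt (ht x hx), fun S e v V hv => ht' S e.1 v V hv.fst⟩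

instance IsTerm.snd : IsTerm M fun e : E × M.carrier => e.2 where
  out := ⟨[], fun L' _ => ⟨.var (L'.length + Env.len M E), fun x hx => by
    simp only [Term.vars, Finset.mem_singleton] at hx
    exact hx ▸ Nat.lt_succ_self _, fun S e v V hv => hv.snd⟩⟩

-- Unification does not find `f` from `f e.1`, so the variables are listed one by one.
instance IsTerm.var1 : IsTerm M fun e : (E × M.carrier) × M.carrier => e.1.2 := .fst .snd
instance IsTerm.var2 : IsTerm M
  fun e : ((E × M.carrier) × M.carrier) × M.carrier => e.1.1.2 := .fst .var1
instance IsTerm.var3 : IsTerm M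
  fun e : (((E × M.carrier) × M.carrier) × M.carrier) × M.carrier => e.1.1.1.2 := .fst .var2
instance IsTerm.var4 : IsTerm M
  fun e : ((((E × M.carrier) × M.carrier) × M.carrier) × M.carrier) × M.carrier =>
    e.1.1.1.1.2 := .fst .var3

instance IsTerm.add [hf : IsTerm M f] [hg : IsTerm M g] : IsTerm M fun e => f e + g e where
  out := by
    obtain ⟨L₁, h₁⟩ := hf.out
    obtain ⟨L₂, h₂⟩ := hg.out
    refine ⟨L₁ ++ L₂, fun L' h => ?_⟩
    obtain ⟨s, hs, hs'⟩ := h₁ L' (List.append_subset.1 h).1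
    obtain ⟨t, ht, ht'⟩ := h₂ L' (List.append_subset.1 h).2
    refine ⟨.add s t, fun x hx => ?_, fun S e v V hv => ?_⟩
    · exact (Finset.mem_union.1 hx).elim (hs x) (ht x)
    · rw [Term.eval, hs' S e v V hv, ht' S e v V hv]; rfl

instance IsTerm.mul [hf : IsTerm M f] [hg : IsTerm M g] : IsTerm M fun e => f e * g e where
  out := by
    obtain ⟨L₁, h₁⟩ := hf.out
    obtain ⟨L₂, h₂⟩ := hg.out
    refine ⟨L₁ ++ L₂, fun L' h => ?_⟩
    obtain ⟨s, hs, hs'⟩ := h₁ L' (List.append_subset.1 h).1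
    obtain ⟨t, ht, ht'⟩ := h₂ L' (List.append_subset.1 h).2
    refine ⟨.mul s t, fun x hx => ?_, fun S e v V hv => ?_⟩
    · exact (Finset.mem_union.1 hx).elim (hs x) (ht x)
    · rw [Term.eval, hs' S e v V hv, ht' S e v V hv]; rfl

theorem IsSig0.congr (hp : IsSig0 M p) (h : ∀ e, q e ↔ p e) : IsSig0 M q := by
  rwa [show q = p from funext fun e => propext (h e)]

/-- Atomic formulas built from two terms. -/
theorem IsSig0.of_terms (hf : IsTerm M f) (hg : IsTerm M g) (F : Term → Term → Formula)
    (hF : ∀ s t, IsSigma00 (F s t)) (r : M.carrier → M.carrier → Prop)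
    (hr : ∀ s t v V, (F s t).Realize M v V ↔ r (s.eval M v) (t.eval M v)) :
    IsSig0 M fun e => r (f e) (g e) where
  out := by
    obtain ⟨L₁, h₁⟩ := hf.out
    obtain ⟨L₂, h₂⟩ := hg.out
    refine ⟨L₁ ++ L₂, [], by simp, fun L' S' h _ => ?_⟩
    obtain ⟨s, -, hs⟩ := h₁ L' (List.append_subset.1 h).1
    obtain ⟨t, -, ht⟩ := h₂ L' (List.append_subset.1 h).2
    exact ⟨F s t, hF s t, fun e v V hv => by rw [hr, hs S' e v V hv, ht S' e v V hv]⟩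

instance IsSig0.eq [hf : IsTerm M f] [hg : IsTerm M g] : IsSig0 M fun e => f e = g e :=
  .of_terms hf hg _ .eq (· = ·) fun _ _ _ _ => Iff.rfl

instance IsSig0.lt [hf : IsTerm M f] [hg : IsTerm M g] : IsSig0 M fun e => f e < g e :=
  .of_terms hf hg _ .lt (· < ·) fun _ _ _ _ => Iff.rfl

instance IsSig0.mem [hf : IsTerm M f] (A : M.sets) : IsSig0 M fun e => f e ∈ A.1 where
  out := by
    obtain ⟨L, h⟩ := hf.out
    refine ⟨L, [A.1], by simp, fun L' S' hL hS => ?_⟩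
    obtain ⟨t, -, ht⟩ := h L' hL
    obtain ⟨i, hi, hA⟩ := List.mem_iff_getElem.1 (hS (List.mem_singleton_self A.1))
    refine ⟨_, .mem t i, fun e v V hv => ?_⟩
    rw [Formula.Realize, ht S' e v V hv, hv.set i A.1 (List.getElem?_eq_some_iff.2 ⟨hi, hA⟩)]

instance IsSig0.not [hp : IsSig0 M p] : IsSig0 M fun e => ¬ p e where
  out := by
    obtain ⟨L, S, hS, h⟩ := hp.out
    refine ⟨L, S, hS, fun L' S' h1 h2 => ?_⟩
    obtain ⟨φ, hφ, hφ'⟩ := h L' S' h1 h2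
    exact ⟨_, .neg hφ, fun e v V hv => by rw [Formula.Realize, hφ' e v V hv]⟩

theorem IsSig0.of_sig0 (hp : IsSig0 M p) (hq : IsSig0 M q) (F : Formula → Formula → Formula)
    (hF : ∀ φ ψ, IsSigma00 φ → IsSigma00 ψ → IsSigma00 (F φ ψ)) (r : Prop → Prop → Prop)
    (hr : ∀ φ ψ v V, (F φ ψ).Realize M v V ↔ r (φ.Realize M v V) (ψ.Realize M v V)) :
    IsSig0 M fun e => r (p e) (q e) where
  out := by
    obtain ⟨L₁, S₁, hS₁, h₁⟩ := hp.out
    obtain ⟨L₂, S₂, hS₂, h₂⟩ := hq.out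
    refine ⟨L₁ ++ L₂, S₁ ++ S₂, fun A hA => (List.mem_append.1 hA).elim (hS₁ A) (hS₂ A),
      fun L' S' hL hS => ?_⟩
    obtain ⟨φ, hφ, hφ'⟩ := h₁ L' S' (List.append_subset.1 hL).1 (List.append_subset.1 hS).1
    obtain ⟨ψ, hψ, hψ'⟩ := h₂ L' S' (List.append_subset.1 hL).2 (List.append_subset.1 hS).2
    exact ⟨F φ ψ, hF φ ψ hφ hψ, fun e v V hv => by rw [hr, hφ' e v V hv, hψ' e v V hv]⟩

instance IsSig0.and [hp : IsSig0 M p] [hq : IsSig0 M q] : IsSig0 M fun e => p e ∧ q e :=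
  .of_sig0 hp hq _ (fun _ _ => .and) (· ∧ ·) fun _ _ _ _ => Iff.rfl

instance IsSig0.or [hp : IsSig0 M p] [hq : IsSig0 M q] : IsSig0 M fun e => p e ∨ q e :=
  .of_sig0 hp hq _ (fun _ _ => .or) (· ∨ ·) fun _ _ _ _ => Iff.rfl

instance IsSig0.imp [hp : IsSig0 M p] [hq : IsSig0 M q] : IsSig0 M fun e => p e → q e :=
  .of_sig0 hp hq _ (fun _ _ => .imp) (· → ·) fun _ _ _ _ => Iff.rfl

instance IsSig0.iff [hp : IsSig0 M p] [hq : IsSig0 M q] : IsSig0 M fun e => p e ↔ q e :=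
  .of_sig0 hp hq _ (fun _ _ => .iff) (· ↔ ·) fun _ _ _ _ => Iff.rfl

instance IsSig0.ball {r : E → M.carrier → Prop} [hf : IsTerm M f]
    [hr : IsSig0 M fun e : E × M.carrier => r e.1 e.2] :
    IsSig0 M fun e => ∀ a, a < f e → r e a where
  out := by
    obtain ⟨L₁, h₁⟩ := hf.out
    obtain ⟨L₂, S, hS, h₂⟩ := hr.out
    refine ⟨L₁ ++ L₂, S, hS, fun L' S' hL hS' => ?_⟩
    obtain ⟨t, ht, ht'⟩ := h₁ L' (List.append_subset.1 hL).1
    obtain ⟨φ, hφ, hφ'⟩ := h₂ L' S' (List.append_subset.1 hL).2 hS'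
    refine ⟨_, .ball (L'.length + Env.len M E) t (fun hx => (ht _ hx).false) hφ,
      fun e v V hv => ?_⟩
    refine forall_congr' fun a => ?_
    have hv' := hv.update a
    simp only [Formula.Realize, Term.eval, Function.update_self, hφ' _ _ _ hv',
      ht' S' e _ V hv'.fst]
    rfl

instance IsSig0.bex {r : E → M.carrier → Prop} [hf : IsTerm M f]
    [hr : IsSig0 M fun e : E × M.carrier => r e.1 e.2] :
    IsSig0 M fun e => ∃ a, a < f e ∧ r e a :=
  have : IsSig0 M fun e => ¬ ∀ a, a < f e → ¬ r e a := inferInstance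
  this.congr fun e => by push Not; rfl

instance IsSig1.of_sig0 [hp : IsSig0 M p] : IsSig1 M p where
  out := by
    refine ⟨fun e => p e.1, ⟨?_⟩, fun e => ⟨fun h => ⟨0, h⟩, fun ⟨_, h⟩ => h⟩⟩
    obtain ⟨L, S, hS, h⟩ := hp.out
    refine ⟨L, S, hS, fun L' S' h1 h2 => ?_⟩
    obtain ⟨φ, hφ, hφ'⟩ := h L' S' h1 h2
    exact ⟨φ, hφ, fun e v V hv => hφ' e.1 v V hv.fst⟩

instance IsSig1.exists {r : E → M.carrier → Prop}
    [hr : IsSig0 M fun e : E × M.carrier => r e.1 e.2] : IsSig1 M fun e => ∃ a, r e a where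
  out := ⟨_, hr, fun _ => Iff.rfl⟩

end Closure

/-! ### Induction and comprehension for definable relations -/

/-- `M` is a model of `RCA0`. -/
class ModelsRCA0 (M : Structure.{u}) : Prop where
  sat : ∀ φ ∈ RCA0, M.Satisfies φ

/-- An assignment of the number parameters `L` and the set parameters `S`. -/
theorem exists_fits (L : List M.carrier) (S : List (Set M.carrier)) (hS : ∀ A ∈ S, A ∈ M.sets) :
    ∃ v V, (∀ X, V X ∈ M.sets) ∧ Fits L S () v V := by
  obtain ⟨A₀, hA₀⟩ := M.sets_nonempty
  refine ⟨fun i => L.getD i 0, fun i => S.getD i A₀, fun X => ?_, ⟨?_, ?_, ?_⟩⟩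
  · simp only [List.getD_eq_getElem?_getD]
    cases h : S[X]? with
    | none => exact hA₀
    | some A => exact hS A (List.mem_of_getElem? h)
  · intro i a h; simp [List.getD_eq_getElem?_getD, h]
  · intro i a h; simp [List.getD_eq_getElem?_getD, h]
  · intro i hi; exact absurd hi (Nat.not_lt_zero _)

theorem exists_not_mem_gt (s : Finset ℕ) (n : ℕ) : ∃ y, n < y ∧ y ∉ s := by
  obtain ⟨y, hy, hs⟩ := Set.Infinite.exists_notMem_finset (Set.Ioi_infinite n) s
  exact ⟨y, hy, hs⟩

section Arithmetic

variable [hM : ModelsRCA0 M]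

theorem sigma1_induction (p : M.carrier → Prop) [hp : IsSig1 M fun e : Unit × M.carrier => p e.2]
    (h0 : p 0) (hs : ∀ a, p a → p (a + 1)) : ∀ a, p a := by
  obtain ⟨q, hq, hpq⟩ := hp.out
  obtain ⟨L, S, hS, h⟩ := hq.out
  obtain ⟨φ, hφ, hφ'⟩ := h L S (List.Subset.refl _) (List.Subset.refl _)
  obtain ⟨v, V, hV, hv⟩ := exists_fits L S hS
  -- The induction variable is `L.length`, the unbounded quantifier of `φ` binds `L.length + 1`.
  obtain ⟨y, hy, hyφ⟩ := exists_not_mem_gt (Formula.exN (L.length + 1) φ).freeN (L.length + 1)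
  have key : ∀ w : ℕ → M.carrier, (∀ i < L.length, w i = v i) →
      ((Formula.exN (L.length + 1) φ).Realize M w V ↔ p (w L.length)) := by
    intro w hw
    have h1 : Fits L S ((), w L.length) w V := hv.extend (w := w) hw
    rw [hpq ((), w L.length)]
    exact exists_congr fun b => hφ' _ _ _ (h1.update b)
  have := hM.sat (inductionAxiom (.exN (L.length + 1) φ) L.length y)
    (.inl (.inr ⟨_, _, _, ⟨_, _, hφ, rfl⟩, by omega, hyφ, rfl⟩)) v V hV ⟨?_, ?_⟩
  · intro a
    have ha := this a
    rw [key _ fun i hi => Function.update_of_ne hi.ne _ _] at ha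
    simpa using ha
  · intro a (ha : Function.update v L.length a L.length = 0)
    rw [key _ fun i hi => Function.update_of_ne hi.ne _ _, ha]
    exact h0
  · intro a ha b hb c hc
    rw [key _ fun i hi => Function.update_of_ne hi.ne _ _] at ha
    rw [key _ fun i hi => by
      rw [Function.update_of_ne hi.ne, Function.update_of_ne (by omega),
        Function.update_of_ne hi.ne]]
    have hb' : b = a + 1 := by
      simpa [Formula.Realize, Function.update_of_ne (show L.length ≠ y by omega)] using hb
    have hc' : c = b := by
      simpa [Formula.Realize, Function.update_of_ne (show y ≠ L.length by omega)] using hc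
    simp only [Function.update_self] at ha ⊢
    rw [hc', hb']
    exact hs a ha

theorem sigma0_comprehension (p : M.carrier → Prop)
    [hp : IsSig0 M fun e : Unit × M.carrier => p e.2] : {a | p a} ∈ M.sets := by
  obtain ⟨L, S, hS, h⟩ := hp.out
  obtain ⟨φ, hφ, hφ'⟩ := h L S (List.Subset.refl _) (List.Subset.refl _)
  obtain ⟨v, V, hV, hv⟩ := exists_fits L S hS
  -- A dummy quantifier over `L.length + 1` makes `φ` both `Σ⁰₁` and `Π⁰₁`.
  obtain ⟨X, hX, hXφ⟩ := exists_not_mem_gt (Formula.exN (L.length + 1) φ).freeS S.length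
  have key : ∀ (a b : M.carrier) (A : Set M.carrier),
      (φ.Realize M (Function.update (Function.update v L.length a) (L.length + 1) b) V ↔ p a) ∧
      (φ.Realize M (Function.update (Function.update v L.length a) (L.length + 1) b)
        (Function.update V X A) ↔ p a) := by
    intro a b A
    have h1 : Fits L S ((), a) (Function.update v L.length a) V := hv.update a
    have h2 := (h1.update b).fst
    exact ⟨hφ' _ _ _ h2,
      hφ' _ _ _ (h2.congr_set fun i hi => Function.update_of_ne (by omega) _ _)⟩
  obtain ⟨A, hA, hA'⟩ := hM.sat (comprehensionAxiom (.exN (L.length + 1) φ)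
    (.allN (L.length + 1) φ) L.length X)
    (.inr ⟨_, _, _, _, ⟨_, _, hφ, rfl⟩, ⟨_, _, hφ, rfl⟩, hXφ, rfl⟩) v V hV
    fun a => ⟨fun ⟨b, hb⟩ c => (key a c ∅).1.2 ((key a b ∅).1.1 hb), fun h => ⟨0, h 0⟩⟩
  have : {a | p a} = A := by
    ext a
    have h1 := hA' a
    simp only [Formula.Realize, Term.eval, Function.update_self] at h1
    rw [h1]
    exact ⟨fun h => ⟨0, (key a 0 A).2.2 h⟩, fun ⟨b, hb⟩ => (key a b A).2.1 hb⟩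
  rwa [this]

/-! ### Arithmetic in a model -/

/-- The basic axioms use at most the variables `0` and `1` and no set variables. -/
theorem basicAxiom {φ : Formula} (hφ : φ ∈ basicAxioms) (a b : M.carrier) :
    φ.Realize M (fun i => if i = 0 then a else b) fun _ => M.sets_nonempty.some :=
  hM.sat φ (.inl (.inl hφ)) _ _ fun _ => M.sets_nonempty.some_mem

theorem succ_ne_zero' (a : M.carrier) : a + 1 ≠ 0 :=
  basicAxiom (φ := ¬₂ (#0 + 1 =₂ 0)) (by simp [basicAxioms]) a a

theorem succ_inj' {a b : M.carrier} : a + 1 = b + 1 → a = b :=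
  basicAxiom (φ := #0 + 1 =₂ #1 + 1 ⇒₂ #0 =₂ #1) (by simp [basicAxioms]) a b

theorem add_zero' (a : M.carrier) : a + 0 = a :=
  basicAxiom (φ := #0 + 0 =₂ #0) (by simp [basicAxioms]) a a

theorem add_succ' (a b : M.carrier) : a + (b + 1) = a + b + 1 :=
  basicAxiom (φ := #0 + (#1 + 1) =₂ (#0 + #1) + 1) (by simp [basicAxioms]) a b

theorem mul_zero' (a : M.carrier) : a * 0 = 0 :=
  basicAxiom (φ := #0 * 0 =₂ 0) (by simp [basicAxioms]) a a

theorem mul_succ' (a b : M.carrier) : a * (b + 1) = a * b + a :=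
  basicAxiom (φ := #0 * (#1 + 1) =₂ #0 * #1 + #0) (by simp [basicAxioms]) a b

theorem not_lt_zero' (a : M.carrier) : ¬ a < 0 :=
  basicAxiom (φ := ¬₂ (#0 <₂ 0)) (by simp [basicAxioms]) a a

theorem lt_succ' {a b : M.carrier} : a < b + 1 ↔ a < b ∨ a = b :=
  basicAxiom (φ := #0 <₂ #1 + 1 ⇔₂ (#0 <₂ #1 ∨₂ #0 =₂ #1)) (by simp [basicAxioms]) a b

theorem zero_add' (a : M.carrier) : 0 + a = a :=
  sigma1_induction (fun a => 0 + a = a) (add_zero' 0) (fun a h => by rw [add_succ', h]) a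

theorem succ_add' (a b : M.carrier) : a + 1 + b = a + b + 1 :=
  sigma1_induction (fun b => a + 1 + b = a + b + 1) (by simp only [add_zero'])
    (fun b h => by rw [add_succ', h, add_succ']) b

theorem add_comm' (a b : M.carrier) : a + b = b + a :=
  sigma1_induction (fun b => a + b = b + a) (by rw [add_zero', zero_add'])
    (fun b h => by rw [add_succ', h, succ_add']) b

theorem add_assoc' (a b c : M.carrier) : a + b + c = a + (b + c) :=
  sigma1_induction (fun c => a + b + c = a + (b + c)) (by rw [add_zero', add_zero'])
    (fun c h => by rw [add_succ', h, add_succ', add_succ']) c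

theorem zero_mul' (a : M.carrier) : 0 * a = 0 :=
  sigma1_induction (fun a => 0 * a = 0) (mul_zero' 0) (fun a h => by rw [mul_succ', h, add_zero']) a

theorem succ_mul' (a b : M.carrier) : (a + 1) * b = a * b + b :=
  sigma1_induction (fun b => (a + 1) * b = a * b + b) (by simp only [mul_zero', add_zero'])
    (fun b h => by
      rw [mul_succ', h, mul_succ', add_assoc', add_assoc', add_comm' b, add_assoc', add_comm' 1]) b

theorem mul_comm' (a b : M.carrier) : a * b = b * a :=
  sigma1_induction (fun b => a * b = b * a) (by rw [mul_zero', zero_mul'])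
    (fun b h => by rw [mul_succ', h, succ_mul']) b

theorem mul_add' (a b c : M.carrier) : a * (b + c) = a * b + a * c :=
  sigma1_induction (fun c => a * (b + c) = a * b + a * c) (by simp only [mul_zero', add_zero'])
    (fun c h => by rw [add_succ', mul_succ', h, mul_succ', add_assoc']) c

theorem mul_assoc' (a b c : M.carrier) : a * b * c = a * (b * c) :=
  sigma1_induction (fun c => a * b * c = a * (b * c)) (by simp only [mul_zero'])
    (fun c h => by rw [mul_succ', h, mul_succ', mul_add']) c

theorem mul_one' (a : M.carrier) : a * 1 = a := by
  rw [← zero_add' 1, mul_succ', mul_zero', zero_add']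

instance : CommSemiring M.carrier where
  add_assoc := add_assoc'
  zero_add := zero_add'
  add_zero := add_zero'
  add_comm := add_comm'
  mul_assoc := mul_assoc'
  one_mul a := by rw [mul_comm', mul_one']
  mul_one := mul_one'
  mul_comm := mul_comm'
  left_distrib := mul_add'
  right_distrib a b c := by rw [mul_comm', mul_add', mul_comm' c, mul_comm' c]
  zero_mul := zero_mul'
  mul_zero := mul_zero'
  nsmul := nsmulRec

theorem add_right_cancel' {a b c : M.carrier} (h : a + c = b + c) : a = b :=
  sigma1_induction (fun c => a + c = b + c → a = b) (by simp)
    (fun c ih h => ih (succ_inj' (by rw [add_assoc, h, add_assoc]))) c h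

theorem eq_zero_or_succ (a : M.carrier) : a = 0 ∨ ∃ b, a = b + 1 := by
  have := sigma1_induction (fun a : M.carrier => ∃ b, a = 0 ∨ a = b + 1) ⟨0, .inl rfl⟩
    (fun a _ => ⟨a, .inr rfl⟩) a
  obtain ⟨b, h | h⟩ := this
  exacts [.inl h, .inr ⟨b, h⟩]

theorem lt_iff_exists_add (a b : M.carrier) : a < b ↔ ∃ c, b = a + c + 1 := by
  constructor
  · refine sigma1_induction (fun b => ∃ c, a < b → b = a + c + 1) ⟨0, fun h => ?_⟩ ?_ b |>.elim
      fun c hc h => ⟨c, hc h⟩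
    · exact absurd h (not_lt_zero' a)
    · rintro b ⟨c, hc⟩
      by_cases h : a < b
      · exact ⟨c + 1, fun _ => by rw [hc h, add_assoc a c 1]⟩
      · refine ⟨0, fun h' => ?_⟩
        rw [(lt_succ'.1 h').resolve_left h, add_zero]
  · rintro ⟨c, rfl⟩
    refine sigma1_induction (fun c => a < a + c + 1) ?_ ?_ c
    · rw [add_zero]; exact lt_succ'.2 (.inr rfl)
    · intro c hc; rw [← add_assoc]; exact lt_succ'.2 (.inl hc)

theorem eq_zero_of_add_eq {a c : M.carrier} (h : a = a + c) : c = 0 :=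
  (add_right_cancel' (c := a) (by rw [zero_add, add_comm, ← h])).symm

theorem total_add (a b : M.carrier) : ∃ c, a = b + c ∨ b = a + c := by
  refine sigma1_induction (fun a => ∃ c, a = b + c ∨ b = a + c) ⟨b, .inr (zero_add b).symm⟩ ?_ a
  rintro a ⟨c, rfl | rfl⟩
  · exact ⟨c + 1, .inl (add_assoc _ _ _)⟩
  · obtain rfl | ⟨d, rfl⟩ := eq_zero_or_succ c
    · exact ⟨1, .inl (by rw [add_zero])⟩
    · exact ⟨d, .inr (by rw [add_assoc, add_comm 1])⟩

theorem lt_or_eq_iff_exists_add {a b : M.carrier} : (a < b ∨ a = b) ↔ ∃ c, b = a + c := by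
  constructor
  · rintro (h | rfl)
    · obtain ⟨c, rfl⟩ := (lt_iff_exists_add a b).1 h
      exact ⟨c + 1, add_assoc _ _ _⟩
    · exact ⟨0, (add_zero a).symm⟩
  · rintro ⟨c, rfl⟩
    obtain rfl | ⟨d, rfl⟩ := eq_zero_or_succ c
    · exact .inr (add_zero a).symm
    · exact .inl ((lt_iff_exists_add _ _).2 ⟨d, (add_assoc _ _ _).symm⟩)

theorem lt_irrefl' (a : M.carrier) : ¬ a < a := fun h => by
  obtain ⟨c, hc⟩ := (lt_iff_exists_add a a).1 h
  exact succ_ne_zero' c (eq_zero_of_add_eq (by rwa [add_assoc] at hc))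

theorem lt_trans' {a b c : M.carrier} (h1 : a < b) (h2 : b < c) : a < c := by
  obtain ⟨d, rfl⟩ := (lt_iff_exists_add _ _).1 h1
  obtain ⟨e, rfl⟩ := (lt_iff_exists_add _ _).1 h2
  exact (lt_iff_exists_add _ _).2 ⟨d + 1 + e, by simp only [add_assoc]⟩

noncomputable instance : LinearOrder M.carrier where
  le a b := a < b ∨ a = b
  le_refl a := .inr rfl
  le_trans a b c := by
    rintro (h1 | rfl) (h2 | rfl)
    exacts [.inl (lt_trans' h1 h2), .inl h1, .inl h2, .inr rfl]
  lt_iff_le_not_ge a b := by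
    refine ⟨fun h => ⟨.inl h, ?_⟩, fun ⟨h, h'⟩ => h.resolve_right fun h2 => h' (.inr h2.symm)⟩
    rintro (h' | rfl)
    exacts [lt_irrefl' _ (lt_trans' h h'), lt_irrefl' _ h]
  le_antisymm a b := by
    rintro (h1 | rfl) (h2 | h2)
    exacts [absurd (lt_trans' h1 h2) (lt_irrefl' _), h2.symm, rfl, rfl]
  le_total a b := by
    obtain ⟨c, h | h⟩ := total_add a b
    exacts [.inr (lt_or_eq_iff_exists_add.2 ⟨c, h⟩), .inl (lt_or_eq_iff_exists_add.2 ⟨c, h⟩)]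
  toDecidableLE := Classical.decRel _

-- `n < N + 1` is used throughout in place of `n ≤ N`, since quantifier bounds are strict.
theorem lt_add_one_iff' {a b : M.carrier} : a < b + 1 ↔ a ≤ b := lt_succ'

theorem add_one_le_iff' {a b : M.carrier} : a + 1 ≤ b ↔ a < b := by
  constructor
  · intro h
    exact lt_of_lt_of_le (lt_add_one_iff'.2 le_rfl) h
  · intro h
    obtain ⟨c, rfl⟩ := (lt_iff_exists_add _ _).1 h
    exact lt_or_eq_iff_exists_add.2 ⟨c, by ring⟩

instance : CanonicallyOrderedAdd M.carrier where
  exists_add_of_le h := lt_or_eq_iff_exists_add.1 h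
  le_self_add _ b := lt_or_eq_iff_exists_add.2 ⟨b, rfl⟩
  le_add_self _ b := lt_or_eq_iff_exists_add.2 ⟨b, add_comm _ _⟩

instance : IsOrderedCancelAddMonoid M.carrier where
  add_le_add_left _ _ h c := by
    obtain ⟨d, rfl⟩ := exists_add_of_le h
    exact lt_or_eq_iff_exists_add.2 ⟨d, by ring⟩
  le_of_add_le_add_left a _ _ h := by
    obtain ⟨d, hd⟩ := exists_add_of_le h
    exact lt_or_eq_iff_exists_add.2 ⟨d, add_right_cancel' (c := a) (by rw [add_comm, hd]; ring)⟩

instance : IsStrictOrderedRing M.carrier := by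
  have hpos : ∀ a b c : M.carrier, 0 < a → b < c → a * b < a * c := by
    intro a b c ha h
    obtain ⟨d, rfl⟩ := (lt_iff_exists_add _ _).1 h
    obtain ⟨a, rfl⟩ := (lt_iff_exists_add _ _).1 ha
    exact (lt_iff_exists_add _ _).2 ⟨a * d + a + d, by ring⟩
  exact {
    zero_le_one := zero_le
    exists_pair_ne := ⟨0, 1, fun h => succ_ne_zero' (0 : M.carrier) (by rw [zero_add, ← h])⟩
    mul_lt_mul_of_pos_left := fun a ha b c h => hpos a b c ha h
    mul_lt_mul_of_pos_right := fun a ha b c h => by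
      rw [mul_comm b, mul_comm c]; exact hpos a b c ha h }

/-! ### Divisibility, least elements, coding of bounded sets -/

section Closure

variable {E : Type*} [Env M E] {f g : E → M.carrier}

instance IsSig0.le [IsTerm M f] [IsTerm M g] : IsSig0 M fun e => f e ≤ g e :=
  inferInstanceAs (IsSig0 M fun e => f e < g e ∨ f e = g e)

theorem le_mul_of_ne_zero {a b : M.carrier} (hb : b ≠ 0) : a ≤ a * b := by
  obtain rfl | ⟨c, rfl⟩ := eq_zero_or_succ b
  · exact absurd rfl hb
  · rw [mul_add, mul_one]; exact le_add_self

theorem dvd_iff_bounded {a b : M.carrier} : a ∣ b ↔ ∃ q, q < b + 1 ∧ b = a * q := by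
  refine ⟨fun ⟨q, hq⟩ => ?_, fun ⟨q, _, hq⟩ => ⟨q, hq⟩⟩
  by_cases ha : a = 0
  · exact ⟨0, lt_add_one_iff'.2 zero_le, by rw [hq, ha, zero_mul, zero_mul]⟩
  · exact ⟨q, lt_add_one_iff'.2 (hq ▸ mul_comm q a ▸ le_mul_of_ne_zero ha), hq⟩

instance IsSig0.dvd [hf : IsTerm M f] [hg : IsTerm M g] : IsSig0 M fun e => f e ∣ g e :=
  have := hf.fst
  have := hg.fst
  have : IsSig0 M fun e => ∃ q, q < g e + 1 ∧ g e = f e * q := inferInstance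
  this.congr fun _ => dvd_iff_bounded

end Closure

theorem exists_least (A : M.sets) {a : M.carrier} (ha : a ∈ A.1) :
    ∃ b ∈ A.1, ∀ c < b, c ∉ A.1 := by
  by_contra! h
  refine sigma1_induction (fun x => ∀ y, y < x + 1 → ¬ y ∈ A.1) ?_ ?_ a a
    (lt_add_one_iff'.2 le_rfl) ha
  · intro y hy hyA
    obtain ⟨c, hc, -⟩ := h y hyA
    exact not_lt_zero' c (lt_of_lt_of_le hc (lt_add_one_iff'.1 hy))
  · intro x hx y hy hyA
    obtain ⟨c, hc, hcA⟩ := h y hyA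
    exact hx c (lt_of_lt_of_le hc (lt_add_one_iff'.1 hy)) hcA

theorem exists_common_multiple (k : M.carrier) :
    ∃ m : M.carrier, m ≠ 0 ∧ ∀ i, i < k → i + 1 ∣ m := by
  refine sigma1_induction (fun k : M.carrier => ∃ m : M.carrier, m ≠ 0 ∧ ∀ i, i < k → i + 1 ∣ m)
    ⟨1, one_ne_zero, fun i hi => absurd hi (not_lt_zero' i)⟩ ?_ k
  rintro k ⟨m, hm, h⟩
  refine ⟨m * (k + 1), mul_ne_zero hm (succ_ne_zero' k), fun i hi => ?_⟩
  obtain hi | rfl := (lt_add_one_iff'.1 hi).lt_or_eq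
  exacts [(h i hi).mul_right _, dvd_mul_left _ _]

theorem dvd_of_dvd_add {a b c : M.carrier} (h : a ∣ b + c) (hc : a ∣ c) : a ∣ b := by
  obtain ⟨s, hs⟩ := h
  obtain ⟨t, rfl⟩ := hc
  obtain h | h := le_total t s
  · obtain ⟨r, rfl⟩ := exists_add_of_le h
    exact ⟨r, add_right_cancel' (c := a * t) (by rw [hs]; ring)⟩
  · obtain ⟨r, rfl⟩ := exists_add_of_le h
    have : b + a * r = 0 := add_right_cancel' (c := a * s) (by
      rw [zero_add]; exact (by ring : _ = b + a * (s + r)).trans hs)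
    rw [(add_eq_zero.1 this).1]
    exact dvd_zero a

/-- The moduli `m (i + 1) + 1` for `i < k` are pairwise coprime. -/
theorem dvd_of_dvd_modulus_mul {k m i j n : M.carrier} (hm : ∀ i, i < k → i + 1 ∣ m)
    (hi : i < k) (hj : j < k) (hij : i ≠ j)
    (h : m * (i + 1) + 1 ∣ (m * (j + 1) + 1) * n) : m * (i + 1) + 1 ∣ n := by
  obtain ⟨r, hr⟩ := h
  -- With `d = |j - i|` and `m = d q`, the number `q (i + 1) ^ 2` is up to sign the inverse of
  -- `m (j + 1) + 1` modulo `m (i + 1) + 1`, because `m (i + 1)` is congruent to `-1`.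
  obtain hlt | hlt := lt_or_gt_of_ne hij
  · obtain ⟨d, rfl⟩ := (lt_iff_exists_add _ _).1 hlt
    have hd : d < k := lt_of_le_of_lt (le_add_self.trans le_self_add) hj
    obtain ⟨q, hq⟩ := hm d hd
    refine dvd_of_dvd_add (c := (m * (i + 1) + 1) *
      (q * (i + 1) * (i + 1) * n + (m * (i + 1) + 1) * n))
      ⟨r * (q * (i + 1) * (i + 1)) + (n + n), ?_⟩ (dvd_mul_right _ _)
    have : (m * (i + 1) + 1) * (r * (q * (i + 1) * (i + 1)) + (n + n)) =
        (m * (i + 1) + 1) * r * (q * (i + 1) * (i + 1)) + (m * (i + 1) + 1) * (n + n) := by ring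
    rw [this, ← hr, hq]
    ring
  · obtain ⟨d, rfl⟩ := (lt_iff_exists_add _ _).1 hlt
    have hd : d < k := lt_of_le_of_lt (le_add_self.trans le_self_add) hi
    obtain ⟨q, hq⟩ := hm d hd
    set i := j + d + 1 with hi'
    refine dvd_of_dvd_add (c := (m * (i + 1) + 1) *
      (r * (q * (i + 1) * (i + 1)) + (m * (i + 1) + 1) * n))
      ⟨q * (i + 1) * (i + 1) * n + (n + n), ?_⟩ (dvd_mul_right _ _)
    have : (m * (i + 1) + 1) * (r * (q * (i + 1) * (i + 1)) + (m * (i + 1) + 1) * n) =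
        (m * (i + 1) + 1) * r * (q * (i + 1) * (i + 1)) +
          (m * (i + 1) + 1) * ((m * (i + 1) + 1) * n) := by ring
    rw [this, ← hr, hq, hi']
    ring

theorem not_modulus_dvd_one {m : M.carrier} (hm : m ≠ 0) (i : M.carrier) :
    ¬ m * (i + 1) + 1 ∣ 1 := by
  rintro ⟨q, hq⟩
  obtain rfl | ⟨r, rfl⟩ := eq_zero_or_succ q
  · rw [mul_zero] at hq; exact one_ne_zero hq
  · have : m * (i + 1) * (r + 1) + r = 0 :=
      add_right_cancel' (c := 1) (by rw [zero_add]; conv_rhs => rw [hq]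
                                     ring)
    exact mul_ne_zero (mul_ne_zero hm (succ_ne_zero' i)) (succ_ne_zero' r) (add_eq_zero.1 this).1

/-- Every set of the model is described, below `k`, by the divisors of some number `n` among the
moduli `m (i + 1) + 1`. -/
theorem exists_dvd_iff_mem (A : M.sets) {k m : M.carrier} (hm0 : m ≠ 0)
    (hm : ∀ i, i < k → i + 1 ∣ m) : ∃ n, ∀ i, i < k → (m * (i + 1) + 1 ∣ n ↔ i ∈ A.1) := by
  suffices h : ∀ j, ∃ n, ∀ i, i < k → (m * (i + 1) + 1 ∣ n ↔ i < j ∧ i ∈ A.1) by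
    obtain ⟨n, hn⟩ := h k
    exact ⟨n, fun i hi => by rw [hn i hi, and_iff_right hi]⟩
  refine sigma1_induction _ ⟨1, fun i _ => ⟨fun h => absurd h (not_modulus_dvd_one hm0 i),
    fun h => absurd h.1 (not_lt_zero' i)⟩⟩ ?_
  · rintro j ⟨n, hn⟩
    by_cases hj : j < k ∧ j ∈ A.1
    · refine ⟨(m * (j + 1) + 1) * n, fun i hi => ?_⟩
      by_cases hij : i = j
      · subst hij
        exact ⟨fun _ => ⟨lt_add_one_iff'.2 le_rfl, hj.2⟩, fun _ => dvd_mul_right _ _⟩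
      · rw [lt_add_one_iff', le_iff_lt_or_eq, or_iff_left hij, ← hn i hi]
        exact ⟨dvd_of_dvd_modulus_mul hm hi hj.1 hij, fun h => h.mul_left _⟩
    · refine ⟨n, fun i hi => (hn i hi).trans ?_⟩
      rw [lt_add_one_iff', le_iff_lt_or_eq]
      refine ⟨fun h => ⟨.inl h.1, h.2⟩, fun h => ⟨h.1.resolve_right ?_, h.2⟩⟩
      rintro rfl
      exact hj ⟨hi, h.2⟩

/-- The code of the pair `(x, y)`. -/
def pr (x y : M.carrier) : M.carrier := (x + y) * (x + y) + x

omit hM in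
theorem eval_pair (s t : Term) (v : ℕ → M.carrier) :
    (pair s t).eval M v = pr (s.eval M v) (t.eval M v) := rfl

theorem left_le_pr (x y : M.carrier) : x ≤ pr x y := le_add_self

theorem right_le_pr (x y : M.carrier) : y ≤ pr x y := by
  refine le_trans ?_ (le_self_add (a := (x + y) * (x + y)))
  by_cases h : x + y = 0
  · rw [(add_eq_zero.1 h).2]; exact zero_le
  · exact le_add_self.trans (le_mul_of_ne_zero h)

theorem pr_lt_of_add_lt {x y x' y' : M.carrier} (h : x + y < x' + y') : pr x y < pr x' y' := by
  obtain ⟨d, hd⟩ := (lt_iff_exists_add _ _).1 h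
  exact (lt_iff_exists_add _ _).2
    ⟨d * d + d + d + (x + y) * d + (x + y) * d + x + y + y + x', by unfold pr; rw [hd]; ring⟩

theorem pr_inj {x y x' y' : M.carrier} (h : pr x y = pr x' y') : x = x' ∧ y = y' := by
  obtain hlt | heq | hlt := lt_trichotomy (x + y) (x' + y')
  · exact absurd (pr_lt_of_add_lt hlt) (h ▸ lt_irrefl _)
  · unfold pr at h
    rw [heq] at h
    have hx := add_left_cancel h
    subst hx
    exact ⟨rfl, add_left_cancel heq⟩
  · exact absurd (pr_lt_of_add_lt hlt) (h ▸ lt_irrefl _)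

instance {E : Type*} [Env M E] {f g : E → M.carrier} [IsTerm M f] [IsTerm M g] :
    IsTerm M fun e => pr (f e) (g e) := by
  unfold pr; infer_instance

/-- Strong collection for the sections of a set, from `Σ⁰₁` induction: a single `w` bounds, for each
`i < k` for which some `d ∈ D` with `(d, i) ∈ S` exists, one such `d`. -/
theorem strong_collection (D S : M.sets) (k : M.carrier) :
    ∃ w, ∀ i, i < k → ∀ d ∈ D.1, pr d i ∈ S.1 → ∃ d', d' < w ∧ d' ∈ D.1 ∧ pr d' i ∈ S.1 := by
  by_contra! hcon
  obtain ⟨m, hm0, hm⟩ := exists_common_multiple k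
  obtain ⟨N, hN0, hN⟩ := exists_common_multiple (m * (k + 1) + 1)
  -- Each `w` yields a factorization `N = n q` in which `q` keeps the moduli of the `i < k` for which
  -- no `d < w` has been found. Since `w` is never a bound, `n` can be made larger than any `x`.
  suffices h : ∀ x, ∃ w, ∃ n, n < N + 1 ∧ ∃ q, q < N + 1 ∧ x ≤ n ∧ n * q = N ∧
      ∀ i, i < k → m * (i + 1) + 1 ∣ q ∨ ∃ d', d' < w ∧ d' ∈ D.1 ∧ pr d' i ∈ S.1 by
    obtain ⟨w, n, hn, q, hq, hx, -⟩ := h (N + 1)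
    exact absurd hx (not_le.2 hn)
  refine sigma1_induction _ ?_ ?_
  · refine ⟨0, 1, lt_add_one_iff'.2 (by
      have := le_mul_of_ne_zero (a := 1) hN0
      rwa [one_mul] at this), N, lt_add_one_iff'.2 le_rfl, zero_le, one_mul N, fun i hi => .inl ?_⟩
    refine hN _ (lt_add_one_iff'.2 ?_)
    exact mul_le_mul_right (add_one_le_iff'.2 (hi.trans (lt_add_one_iff'.2 le_rfl))) m
  · rintro x ⟨w, n, hn, q, hq, hx, hnq, h⟩
    obtain ⟨i, hi, d, hd, hdS, hw⟩ := hcon w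
    obtain ⟨q, rfl⟩ | ⟨d', hd', hdD, hdS'⟩ := h i hi
    swap
    · exact absurd hdS' (hw d' hd' hdD)
    have hq0 : q ≠ 0 := by rintro rfl; exact hN0 (by rw [← hnq, mul_zero, mul_zero])
    have hn0 : n ≠ 0 := by rintro rfl; exact hN0 (by rw [← hnq, zero_mul])
    have hN' : n * (m * (i + 1) + 1) * q = N := by rw [← hnq, mul_assoc]
    refine ⟨w + d + 1, n * (m * (i + 1) + 1), lt_add_one_iff'.2 ?_, q, lt_add_one_iff'.2 ?_, ?_,
      hN', fun j hj => ?_⟩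
    · rw [← hN']; exact le_mul_of_ne_zero hq0
    · rw [← hN', mul_comm]
      exact le_mul_of_ne_zero (mul_ne_zero hn0 (succ_ne_zero' _))
    · rw [mul_add, mul_one, add_comm]
      refine add_le_add ?_ hx
      by_contra! hlt
      have hlt' : n * (m * (i + 1)) < 0 + 1 := by rwa [zero_add]
      exact mul_ne_zero hn0 (mul_ne_zero hm0 (succ_ne_zero' i))
        (le_antisymm (lt_add_one_iff'.1 hlt') zero_le)
    · by_cases hij : j = i
      · subst hij
        exact .inr ⟨d, lt_add_one_iff'.2 le_add_self, hd, hdS⟩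
      · obtain hdvd | ⟨d', hd', hdD, hdS'⟩ := h j hj
        · exact .inl (dvd_of_dvd_modulus_mul hm hj hi hij hdvd)
        · exact .inr ⟨d', lt_add_one_iff'.2 (hd'.le.trans le_self_add), hdD, hdS'⟩

end Arithmetic

/-! ### Codes of finite sets and of binary strings -/

/-- `c` is the code of a triple. -/
def Triple (c : M.carrier) : Prop := ∃ k m n, c = pr k (pr m n)

/-- `i` is in the finite set described by the triple `c`. -/
def InFin (i c : M.carrier) : Prop :=
  ∃ k m n, c = pr k (pr m n) ∧ i < k ∧ ∃ q, n = q * (m * (i + 1) + 1)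

/-- `c` is the least triple that describes its finite set. -/
def FinCode (c : M.carrier) : Prop :=
  Triple c ∧ ¬ ∃ c', c' < c ∧ Triple c' ∧ ∀ i, InFin i c' ↔ InFin i c

/-- `s` is the code of a binary string of length `l`. -/
def BinString (s l : M.carrier) : Prop :=
  FinCode s ∧ (∀ p, InFin p s → ∃ i b, p = pr i b ∧ i < l ∧ (b = 0 ∨ b = 1)) ∧
    ∀ i, i < l → (InFin (pr i 0) s ↔ ¬ InFin (pr i 1) s)

section Realize

theorem eval_update_of_lt {t : Term} {n x : ℕ} (ht : ∀ y ∈ t.vars, y < n) (hx : n ≤ x)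
    (v : ℕ → M.carrier) (a : M.carrier) : t.eval M (Function.update v x a) = t.eval M v :=
  eval_congr t fun y hy => Function.update_of_ne (by have := ht y hy; omega) _ _

variable {s t : Term} (v : ℕ → M.carrier) (V : ℕ → Set M.carrier)

theorem realize_inFin (hs : ∀ y ∈ s.vars, y < 20) (ht : ∀ y ∈ t.vars, y < 20) :
    (inFin s t).Realize M v V ↔ InFin (s.eval M v) (t.eval M v) := by
  simp [inFin, InFin, Formula.Realize, eval_pair, eval_update_of_lt hs, eval_update_of_lt ht]

theorem realize_isTriple (ht : ∀ y ∈ t.vars, y < 20) :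
    (isTriple t).Realize M v V ↔ Triple (t.eval M v) := by
  simp [isTriple, Triple, Formula.Realize, eval_pair, eval_update_of_lt ht]

theorem realize_isFinCode (ht : ∀ y ∈ t.vars, y < 18) :
    (isFinCode t).Realize M v V ↔ FinCode (t.eval M v) := by
  have ht' : ∀ y ∈ t.vars, y < 20 := fun y hy => (ht y hy).trans (by norm_num)
  have h18 : ∀ y ∈ (Term.var 18).vars, y < 20 := by decide
  have h19 : ∀ y ∈ (Term.var 19).vars, y < 20 := by decide
  simp [isFinCode, FinCode, Formula.Realize, realize_isTriple _ _ h18, realize_isTriple _ _ ht',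
    realize_inFin _ _ h19 h18, realize_inFin _ _ h19 ht', eval_update_of_lt ht]

theorem realize_isBinString (hs : ∀ y ∈ s.vars, y < 15) (ht : ∀ y ∈ t.vars, y < 15) :
    (isBinString s t).Realize M v V ↔ BinString (s.eval M v) (t.eval M v) := by
  have hs' : ∀ y ∈ s.vars, y < 18 := fun y hy => (hs y hy).trans (by norm_num)
  have hs'' : ∀ y ∈ s.vars, y < 20 := fun y hy => (hs y hy).trans (by norm_num)
  have h15 : ∀ y ∈ (Term.var 15).vars, y < 20 := by decide
  have h0 : ∀ y ∈ (pair (.var 16) 0).vars, y < 20 := by decide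
  have h1 : ∀ y ∈ (pair (.var 16) 1).vars, y < 20 := by decide
  simp only [isBinString, BinString, Formula.Realize, realize_isFinCode v V hs',
    realize_inFin _ _ h15 hs'', realize_inFin _ _ h0 hs'', realize_inFin _ _ h1 hs'']
  simp [eval_update_of_lt hs, eval_update_of_lt ht, eval_pair]

end Realize

variable [hM : ModelsRCA0 M]

theorem InFin.lt {i c : M.carrier} (h : InFin i c) : i < c := by
  obtain ⟨k, m, n, rfl, hi, -⟩ := h
  exact lt_of_lt_of_le hi (left_le_pr _ _)

theorem triple_iff_bounded {c : M.carrier} : Triple c ↔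
    ∃ k, k < c + 1 ∧ ∃ m, m < c + 1 ∧ ∃ n, n < c + 1 ∧ c = pr k (pr m n) := by
  refine ⟨?_, fun ⟨k, _, m, _, n, _, h⟩ => ⟨k, m, n, h⟩⟩
  rintro ⟨k, m, n, rfl⟩
  exact ⟨k, lt_add_one_iff'.2 (left_le_pr _ _),
    m, lt_add_one_iff'.2 ((left_le_pr _ _).trans (right_le_pr _ _)),
    n, lt_add_one_iff'.2 ((right_le_pr _ _).trans (right_le_pr _ _)), rfl⟩

theorem inFin_iff_bounded {i c : M.carrier} : InFin i c ↔
    ∃ k, k < c + 1 ∧ ∃ m, m < c + 1 ∧ ∃ n, n < c + 1 ∧ c = pr k (pr m n) ∧ i < k ∧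
      m * (i + 1) + 1 ∣ n := by
  refine ⟨?_, fun ⟨k, _, m, _, n, _, h, hi, q, hq⟩ => ⟨k, m, n, h, hi, q, by rw [hq, mul_comm]⟩⟩
  rintro ⟨k, m, n, rfl, hi, q, hq⟩
  exact ⟨k, lt_add_one_iff'.2 (left_le_pr _ _),
    m, lt_add_one_iff'.2 ((left_le_pr _ _).trans (right_le_pr _ _)),
    n, lt_add_one_iff'.2 ((right_le_pr _ _).trans (right_le_pr _ _)), rfl, hi, q,
    by rw [hq, mul_comm]⟩

/-- The equality of the two finite sets need only be tested below the larger code. -/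
theorem finCode_iff_bounded {c : M.carrier} : FinCode c ↔
    Triple c ∧ ¬ ∃ c', c' < c ∧ Triple c' ∧ ∀ i, i < c → (InFin i c' ↔ InFin i c) := by
  refine and_congr_right fun _ => not_congr (exists_congr fun c' => and_congr_right fun hc' =>
    and_congr_right fun _ => ⟨fun h i _ => h i, fun h i => ?_⟩)
  by_cases hi : i < c
  · exact h i hi
  · exact ⟨fun h' => absurd (h'.lt.trans hc') hi, fun h' => absurd h'.lt hi⟩

theorem binString_iff_bounded {s l : M.carrier} : BinString s l ↔
    FinCode s ∧ (∀ p, p < s → InFin p s →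
      ∃ i, i < p + 1 ∧ ∃ b, b < p + 1 ∧ p = pr i b ∧ i < l ∧ (b = 0 ∨ b = 1)) ∧
    ∀ i, i < l → (InFin (pr i 0) s ↔ ¬ InFin (pr i 1) s) := by
  refine and_congr_right fun _ => and_congr_left fun _ => ⟨fun h p _ hp => ?_, fun h p hp => ?_⟩
  · obtain ⟨i, b, rfl, h⟩ := h p hp
    exact ⟨i, lt_add_one_iff'.2 (left_le_pr _ _), b, lt_add_one_iff'.2 (right_le_pr _ _), rfl, h⟩
  · obtain ⟨i, -, b, -, h⟩ := h p hp.lt hp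
    exact ⟨i, b, h⟩

section Closure

variable {E : Type*} [Env M E] {f g : E → M.carrier}

instance IsSig0.triple [hf : IsTerm M f] : IsSig0 M fun e => Triple (f e) :=
  have := hf.fst
  have := hf.fst.fst
  have : IsTerm M fun e : ((E × M.carrier) × M.carrier) × M.carrier => f e.1.1.1 := hf.fst.fst.fst
  have : IsSig0 M fun e => ∃ k, k < f e + 1 ∧ ∃ m, m < f e + 1 ∧ ∃ n, n < f e + 1 ∧
    f e = pr k (pr m n) := inferInstance
  this.congr fun _ => triple_iff_bounded

instance IsSig0.inFin [hf : IsTerm M f] [hg : IsTerm M g] : IsSig0 M fun e => InFin (f e) (g e) :=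
  have := hg.fst
  have := hg.fst.fst
  have : IsTerm M fun e : ((E × M.carrier) × M.carrier) × M.carrier => g e.1.1.1 := hg.fst.fst.fst
  have : IsTerm M fun e : ((E × M.carrier) × M.carrier) × M.carrier => f e.1.1.1 :=
    hf.fst.fst.fst
  have : IsSig0 M fun e => ∃ k, k < g e + 1 ∧ ∃ m, m < g e + 1 ∧ ∃ n, n < g e + 1 ∧
    g e = pr k (pr m n) ∧ f e < k ∧ m * (f e + 1) + 1 ∣ n := inferInstance
  this.congr fun _ => inFin_iff_bounded

instance IsSig0.finCode [hf : IsTerm M f] : IsSig0 M fun e => FinCode (f e) :=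
  have := hf.fst
  have : IsTerm M fun e : (E × M.carrier) × M.carrier => f e.1.1 := hf.fst.fst
  have : IsSig0 M fun e => Triple (f e) ∧ ¬ ∃ c', c' < f e ∧ Triple c' ∧
    ∀ i, i < f e → (InFin i c' ↔ InFin i (f e)) := inferInstance
  this.congr fun _ => finCode_iff_bounded

instance IsSig0.binString [hf : IsTerm M f] [hg : IsTerm M g] :
    IsSig0 M fun e => BinString (f e) (g e) :=
  have := hf.fst
  have : IsTerm M fun e : ((E × M.carrier) × M.carrier) × M.carrier => g e.1.1.1 :=
    hg.fst.fst.fst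
  have : IsSig0 M fun e => FinCode (f e) ∧ (∀ p, p < f e → InFin p (f e) →
      ∃ i, i < p + 1 ∧ ∃ b, b < p + 1 ∧ p = pr i b ∧ i < g e ∧ (b = 0 ∨ b = 1)) ∧
    ∀ i, i < g e → (InFin (pr i 0) (f e) ↔ ¬ InFin (pr i 1) (f e)) := inferInstance
  this.congr fun _ => binString_iff_bounded

end Closure

/-- Every set of the model coincides below `k` with a coded finite set. -/
theorem exists_finCode (A : M.sets) (k : M.carrier) :
    ∃ c, FinCode c ∧ ∀ i, InFin i c ↔ i < k ∧ i ∈ A.1 := by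
  obtain ⟨m, hm0, hm⟩ := exists_common_multiple k
  obtain ⟨n, hn⟩ := exists_dvd_iff_mem A hm0 hm
  -- The bound `c + k` on `i` is harmless, since `c` describes a subset of `{i | i < c}`.
  let B : M.sets := ⟨_, sigma0_comprehension fun c =>
    Triple c ∧ ∀ i, i < c + k → (InFin i c ↔ i < k ∧ i ∈ A.1)⟩
  have hB : ∀ c, c ∈ B.1 ↔ Triple c ∧ ∀ i, InFin i c ↔ i < k ∧ i ∈ A.1 := by
    refine fun c => and_congr_right fun _ => ⟨fun h i => ⟨fun hi => ?_, fun hi => ?_⟩,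
      fun h i _ => h i⟩
    · exact (h i (lt_of_lt_of_le hi.lt le_self_add)).1 hi
    · exact (h i (lt_of_lt_of_le hi.1 le_add_self)).2 hi
  have h0 : pr k (pr m n) ∈ B.1 := by
    refine (hB _).2 ⟨⟨k, m, n, rfl⟩, fun i => ⟨?_, fun ⟨hi, hiA⟩ => ?_⟩⟩
    · rintro ⟨k', m', n', h, hi, q, hq⟩
      obtain ⟨rfl, h'⟩ := pr_inj h
      obtain ⟨rfl, rfl⟩ := pr_inj h'
      exact ⟨hi, (hn i hi).1 ⟨q, by rw [hq, mul_comm]⟩⟩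
    · obtain ⟨q, hq⟩ := (hn i hi).2 hiA
      exact ⟨k, m, n, rfl, hi, q, by rw [hq, mul_comm]⟩
  obtain ⟨c, hc, hmin⟩ := exists_least B h0
  rw [hB] at hc
  refine ⟨c, ⟨hc.1, ?_⟩, hc.2⟩
  rintro ⟨c', hc', ht, h⟩
  exact hmin c' hc' ((hB c').2 ⟨ht, fun i => (h i).trans (hc.2 i)⟩)

/-- Every set of the model has a coded characteristic function on `{i | i < l}`. -/
theorem exists_binString (A : M.sets) (l : M.carrier) :
    ∃ s, BinString s l ∧ ∀ i, i < l → (InFin (pr i 1) s ↔ i ∈ A.1) := by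
  let B : M.sets := ⟨_, sigma0_comprehension fun p =>
    ∃ i, i < l ∧ (p = pr i 1 ∧ i ∈ A.1 ∨ p = pr i 0 ∧ i ∉ A.1)⟩
  obtain ⟨s, hs, h⟩ := exists_finCode B (pr (l + 1) 1)
  have hlt : ∀ i b, i < l → b ≤ 1 → pr i b < pr (l + 1) 1 := fun i b hi hb =>
    pr_lt_of_add_lt (add_lt_add_of_lt_of_le (hi.trans (lt_add_one_iff'.2 le_rfl)) hb)
  have h1 : ∀ i, i < l → (InFin (pr i 1) s ↔ i ∈ A.1) := by
    refine fun i hi => (h _).trans ⟨?_, fun hA => ⟨hlt i 1 hi le_rfl, i, hi, .inl ⟨rfl, hA⟩⟩⟩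
    rintro ⟨-, j, -, ⟨hj, hA⟩ | ⟨hj, -⟩⟩
    · rwa [(pr_inj hj).1]
    · exact absurd (pr_inj hj).2 one_ne_zero
  have h0 : ∀ i, i < l → (InFin (pr i 0) s ↔ i ∉ A.1) := by
    refine fun i hi => (h _).trans ⟨?_, fun hA => ⟨hlt i 0 hi zero_le, i, hi, .inr ⟨rfl, hA⟩⟩⟩
    rintro ⟨-, j, -, ⟨hj, -⟩ | ⟨hj, hA⟩⟩
    · exact absurd (pr_inj hj).2 zero_ne_one
    · rwa [(pr_inj hj).1]
  refine ⟨s, ⟨hs, fun p hp => ?_, fun i hi => by rw [h0 i hi, h1 i hi]⟩, h1⟩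
  obtain ⟨-, i, hi, ⟨rfl, -⟩ | ⟨rfl, -⟩⟩ := (h p).1 hp
  exacts [⟨i, 1, rfl, hi, .inr rfl⟩, ⟨i, 0, rfl, hi, .inl rfl⟩]

theorem BinString.length_le {s l : M.carrier} (h : BinString s l) : l ≤ s := by
  obtain rfl | ⟨l, rfl⟩ := eq_zero_or_succ l
  · exact zero_le
  · have hl : l < l + 1 := lt_add_one_iff'.2 le_rfl
    rw [add_one_le_iff']
    by_cases h1 : InFin (pr l 1) s
    · exact lt_of_le_of_lt (left_le_pr _ _) h1.lt
    · exact lt_of_le_of_lt (left_le_pr _ _) ((h.2.2 l hl).2 h1).lt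

/-- A string included in another one is an initial segment of it. -/
theorem BinString.of_subset {s t l k i : M.carrier} (hs : BinString s l) (ht : BinString t k)
    (h : ∀ p, InFin p t → InFin p s) (hi : i < k) :
    i < l ∧ (InFin (pr i 1) t ↔ InFin (pr i 1) s) := by
  have hl : ∀ b, InFin (pr i b) t → i < l := fun b hb => by
    obtain ⟨j, c, hj, hjl, -⟩ := hs.2.1 _ (h _ hb)
    rwa [(pr_inj hj).1]
  by_cases h1 : InFin (pr i 1) t
  · exact ⟨hl 1 h1, fun _ => h _ h1, fun _ => h1⟩
  · have h0 := (ht.2.2 i hi).2 h1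
    exact ⟨hl 0 h0, fun h' => absurd h' h1,
      fun h' => absurd h' ((hs.2.2 i (hl 0 h0)).1 (h _ h0))⟩

/-! ### Weak König's lemma -/

/-- Weak König's lemma for trees given by a `Σ⁰₀` condition `θ` on strings and their lengths that is
inherited by initial segments and met by strings of every length: some set has all its initial
segments in the tree. -/
theorem exists_set_of_approximations (hW : M.Satisfies weakKonig)
    (θ : M.carrier → M.carrier → Prop)
    [IsSig0 M fun e : (Unit × M.carrier) × M.carrier => θ e.1.2 e.2]
    (hmono : ∀ s t l k, BinString s l → BinString t k → (∀ p, InFin p t → InFin p s) → θ s l →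
      θ t k)
    (hex : ∀ l, ∃ s, BinString s l ∧ θ s l) :
    ∃ I : M.sets, ∀ l, ∃ s, θ s l ∧ ∀ i, i < l → (InFin (pr i 1) s ↔ i ∈ I.1) := by
  let T : M.sets := ⟨_, sigma0_comprehension fun s => ∃ l, l < s + 1 ∧ BinString s l ∧ θ s l⟩
  have hT : ∀ s, s ∈ T.1 ↔ ∃ l, BinString s l ∧ θ s l := fun s =>
    ⟨fun ⟨l, _, h⟩ => ⟨l, h⟩, fun ⟨l, h⟩ => ⟨l, lt_add_one_iff'.2 h.1.length_le, h⟩⟩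
  obtain ⟨A₀, hA₀⟩ := M.sets_nonempty
  have key := hW (fun _ => 0) (fun _ => A₀) (fun _ => hA₀) T.1 T.2
  have hbin : ∀ {x y : ℕ}, x < 15 → y < 15 → ∀ (v : ℕ → M.carrier) V,
      (isBinString #x #y).Realize M v V ↔ BinString (v x) (v y) := fun hx hy v V =>
    realize_isBinString v V (by simpa [Term.vars] using hx) (by simpa [Term.vars] using hy)
  have hfin : ∀ {x y : ℕ}, x < 15 → y < 15 → ∀ (v : ℕ → M.carrier) V,
      (inFin #x #y).Realize M v V ↔ InFin (v x) (v y) := fun hx hy v V =>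
    realize_inFin v V (by simp [Term.vars]; omega) (by simp [Term.vars]; omega)
  simp [Formula.Realize, isBinTree, infinite, isPath, isBinFunction, hbin, hfin, eval_pair] at key
  obtain ⟨F, hFM, ⟨-, hF⟩, hpath⟩ := key
    (fun s hs => by obtain ⟨l, h, -⟩ := (hT s).1 hs; exact ⟨l, h⟩)
    (fun s t hs k ht hsub => by
      obtain ⟨l, hl, hθ⟩ := (hT s).1 hs
      exact (hT t).2 ⟨k, ht, hmono s t l k hl ht hsub hθ⟩)
    (fun l => by
      obtain ⟨s, hs, hθ⟩ := hex l
      exact ⟨s, (hT s).2 ⟨l, hs, hθ⟩, hs.length_le⟩)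
  let I : M.sets := ⟨_, sigma0_comprehension fun x => pr x 1 ∈ (⟨F, hFM⟩ : M.sets).1⟩
  refine ⟨I, fun l => ?_⟩
  obtain ⟨s, hsT, hs, hsF⟩ := hpath l
  obtain ⟨k, hk, hθ⟩ := (hT s).1 hsT
  refine ⟨s, hmono s s k l hk hs (fun _ => id) hθ, fun i hi => ⟨fun h => hsF _ h, fun h => ?_⟩⟩
  by_contra hi1
  exact (hF i).1 (hsF _ ((hs.2.2 i hi).2 hi1)) h

/-! ### Partial orders with an infinite antichain -/

/-- `A` behaves, below `l`, like an initial interval of `(P, R)` that contains `D` and has no element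
above two distinct elements of `D`. -/
def SeparatesBelow (P R D : Set M.carrier) (A : M.carrier → Prop) (l : M.carrier) : Prop :=
  (∀ x, x < l → A x → x ∈ P) ∧
  (∀ x, x < l → ∀ y, y < l → pr x y ∈ R → A y → A x) ∧
  (∀ d, d < l → d ∈ D → A d) ∧
  ∀ x, x < l → ∀ d, d < l → ∀ d', d' < l → A x → d ∈ D → d' ∈ D → pr d x ∈ R → pr d' x ∈ R →
    d = d'

omit hM in
theorem SeparatesBelow.mono {P R D : Set M.carrier} {A B : M.carrier → Prop} {k l : M.carrier}
    (h : SeparatesBelow P R D A l) (hAB : ∀ i, i < k → i < l ∧ (B i ↔ A i)) :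
    SeparatesBelow P R D B k := by
  obtain ⟨h1, h2, h3, h4⟩ := h
  refine ⟨fun x hx hBx => h1 x (hAB x hx).1 ((hAB x hx).2.1 hBx),
    fun x hx y hy hR hBy => ?_, fun d hd hdD => (hAB d hd).2.2 (h3 d (hAB d hd).1 hdD),
    fun x hx d hd d' hd' hBx => ?_⟩
  · exact (hAB x hx).2.2 (h2 x (hAB x hx).1 y (hAB y hy).1 hR ((hAB y hy).2.1 hBy))
  · exact h4 x (hAB x hx).1 d (hAB d hd).1 d' (hAB d' hd').1 ((hAB x hx).2.1 hBx)

instance (P R D : M.sets) : IsSig0 M fun e : (Unit × M.carrier) × M.carrier =>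
    SeparatesBelow P.1 R.1 D.1 (fun x => InFin (pr x 1) e.1.2) e.2 := by
  unfold SeparatesBelow; infer_instance

/-- `R` is a set of pairs of which the first component is in `P`, and it is reflexive on `P` and
transitive. Antisymmetry plays no role. -/
structure IsPreorderOn (P R : Set M.carrier) : Prop where
  left_mem : ∀ x y, pr x y ∈ R → x ∈ P
  refl : ∀ x ∈ P, pr x x ∈ R
  trans : ∀ x y z, pr x y ∈ R → pr y z ∈ R → pr x z ∈ R

/-- The finite approximations of the separating initial interval are the downward closures of the
finite sets `{d ∈ D | d < l}`. -/
theorem exists_separatesBelow {P R D : M.sets} (hR : IsPreorderOn P.1 R.1)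
    (hDP : ∀ d ∈ D.1, d ∈ P.1) (hD : ∀ d ∈ D.1, ∀ d' ∈ D.1, pr d d' ∈ R.1 → d = d')
    (l : M.carrier) : ∃ A : M.sets, SeparatesBelow P.1 R.1 D.1 (· ∈ A.1) l := by
  refine ⟨⟨_, sigma0_comprehension fun x => ∃ d, d < l ∧ d ∈ D.1 ∧ pr x d ∈ R.1⟩, ?_, ?_, ?_, ?_⟩
  · rintro x - ⟨d, -, -, h⟩
    exact hR.left_mem _ _ h
  · rintro x - y - hxy ⟨d, hd, hdD, h⟩
    exact ⟨d, hd, hdD, hR.trans _ _ _ hxy h⟩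
  · exact fun d hd hdD => ⟨d, hd, hdD, hR.refl d (hDP d hdD)⟩
  · rintro x - d - d' - ⟨e, -, heD, h⟩ hd hd' hdx hdx'
    rw [hD d hd e heD (hR.trans _ _ _ hdx h), hD d' hd' e heD (hR.trans _ _ _ hdx' h)]

/-- Weak König's lemma separates the two `Σ⁰₁` classes `{x | x lies below an element of D}` and
`{x | x lies above two distinct elements of D}` by an initial interval. -/
theorem exists_separating_set (hW : M.Satisfies weakKonig) {P R D : M.sets}
    (hR : IsPreorderOn P.1 R.1) (hDP : ∀ d ∈ D.1, d ∈ P.1)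
    (hD : ∀ d ∈ D.1, ∀ d' ∈ D.1, pr d d' ∈ R.1 → d = d') :
    ∃ I : M.sets, (∀ x ∈ I.1, x ∈ P.1) ∧ (∀ x y, pr x y ∈ R.1 → y ∈ I.1 → x ∈ I.1) ∧
      (∀ d ∈ D.1, d ∈ I.1) ∧ ∀ x ∈ I.1, ∀ d ∈ D.1, ∀ d' ∈ D.1, pr d x ∈ R.1 → pr d' x ∈ R.1 →
        d = d' := by
  obtain ⟨I, hI⟩ := exists_set_of_approximations hW
    (fun s l => SeparatesBelow P.1 R.1 D.1 (fun x => InFin (pr x 1) s) l)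
    (fun s t l k hs ht hsub h => h.mono fun i hi => hs.of_subset ht hsub hi)
    (fun l => by
      obtain ⟨A, hA⟩ := exists_separatesBelow hR hDP hD l
      obtain ⟨s, hs, hsA⟩ := exists_binString A l
      exact ⟨s, hs, hA.mono fun i hi => ⟨hi, hsA i hi⟩⟩)
  have hI' : ∀ l, SeparatesBelow P.1 R.1 D.1 (· ∈ I.1) l := fun l => by
    obtain ⟨s, hs, hsI⟩ := hI l
    exact hs.mono fun i hi => ⟨hi, (hsI i hi).symm⟩
  have hlt : ∀ x y z : M.carrier, x < x + y + z + 1 ∧ y < x + y + z + 1 ∧ z < x + y + z + 1 :=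
    fun x y z => ⟨lt_add_one_iff'.2 (le_self_add.trans le_self_add),
      lt_add_one_iff'.2 (le_add_self.trans le_self_add), lt_add_one_iff'.2 le_add_self⟩
  refine ⟨I, fun x hx => ?_, fun x y hxy hy => ?_, fun d hd => ?_,
    fun x hx d hd d' hd' hdx hdx' => ?_⟩
  · exact (hI' (x + 1)).1 x (lt_add_one_iff'.2 le_rfl) hx
  · exact (hI' _).2.1 x (hlt x y y).1 y (hlt x y y).2.1 hxy hy
  · exact (hI' (d + 1)).2.2.1 d (lt_add_one_iff'.2 le_rfl) hd
  · exact (hI' _).2.2.2 x (hlt x d d').1 d (hlt x d d').2.1 d' (hlt x d d').2.2 hx hd hd' hdx hdx'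

/-- A set with infinitely many elements is not covered by boundedly many sets each of which contains
at most one of its elements. -/
theorem not_covered (D S : M.sets) (hinf : ∀ b, ∃ d ∈ D.1, b ≤ d) (k : M.carrier)
    (hcov : ∀ d ∈ D.1, ∃ i, i < k ∧ pr d i ∈ S.1)
    (hone : ∀ i, i < k → ∀ d ∈ D.1, ∀ d' ∈ D.1, pr d i ∈ S.1 → pr d' i ∈ S.1 → d = d') : False := by
  obtain ⟨w, hw⟩ := strong_collection D S k
  obtain ⟨d, hd, hwd⟩ := hinf w
  obtain ⟨i, hi, hdi⟩ := hcov d hd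
  obtain ⟨d', hd', hdD, hdi'⟩ := hw i hi d hd hdi
  exact absurd hwd (not_le.2 (hone i hi d hd d' hdD hdi hdi' ▸ hd'))

theorem satisfies_antichainStatement (hW : M.Satisfies weakKonig) :
    M.Satisfies antichainStatement := by
  intro v V hV P hP R hR
  rintro ⟨hpo, D, hD, hanti, hinf⟩
  simp [isPartialOrder, isAntichain, infinite, Formula.Realize, eval_pair] at hpo hanti hinf
  obtain ⟨hRP, hrefl, -, htrans⟩ := hpo
  have hord : IsPreorderOn P R := by
    refine ⟨fun x y h => ?_, hrefl, htrans⟩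
    obtain ⟨x', y', hxy, hx, -⟩ := hRP _ h
    rwa [(pr_inj hxy).1]
  obtain ⟨I, hIP, hIR, hDI, hI⟩ := exists_separating_set hW (P := ⟨P, hP⟩) (R := ⟨R, hR⟩)
    (D := ⟨D, hD⟩) hord hanti.1 fun d hd d' hd' h => by
      by_contra hne
      exact (hanti.2 d d' hd hd' hne).1 h
  refine ⟨I.1, I.2, ?_⟩
  simp [isInitialInterval, isFiniteUnionOfIdeals, isIdeal, Formula.Realize, eval_pair]
  refine ⟨⟨hIP, fun x y _ _ => hIR x y⟩, fun k S hS hideal => ?_⟩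
  by_contra! hcov
  refine not_covered ⟨D, hD⟩ ⟨S, hS⟩ hinf k (fun d hd => (hcov d).1 (hDI d hd)) ?_
  intro i hi d hd d' hd' hdS hdS'
  -- An upper bound in the `i`-th ideal lies in `I`, so it is above at most one element of `D`.
  obtain ⟨z, hz, hdz, hdz'⟩ := (hideal i hi).2 d d' hdS hdS'
  exact hI z ((hcov z).2 ⟨i, hi, hz⟩) d hd d' hd' hdz hdz'

end SOA

/-- `WKL0` proves that every partial order with an infinite antichain has an initial interval that
is not a finite union of ideals. -/
theorem theorem5p6 : SOA.Entails.{u} SOA.WKL0 SOA.antichainStatement := fun M hM =>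
  have : SOA.ModelsRCA0 M := ⟨fun φ hφ => hM φ (.inl hφ)⟩
  SOA.satisfies_antichainStatement (hM _ (.inr rfl))
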